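/- Let $\mathbb{H}=\mathbb{R}^3$ be the first Heisenberg group, i.e. $\mathbb{R}^3$ with the sub-Riemannian structure for which $X_1=\partial_x-\frac y2\partial_z$, $X_2=\partial_y+\frac x2\partial_z$ is an orthonormal frame, with scalar product $g$, horizontal gradient $\nabla f=(X_1f)X_1+(X_2f)X_2$, sub-Laplacian $\Delta=X_1^2+X_2^2$, Lebesgue measure $\omega$ and sub-Riemannian distance $d_{\mathrm{SR}}$. For an open set $\Omega\subset\mathbb{H}$ with smooth boundary let $\delta=d_{\mathrm{SR}}(\cdot,\partial\Omega)$, let $N\phi=2g(\nabla\phi,\nabla\delta)+\phi\,\Delta\delta$, and let $\sigma=|i_\nu\omega|$ be the sub-Riemannian surface measure on $\partial\Omega$, where $\nu$ is the horizontal unit normal. A point of $\partial\Omega$ is characteristic if $\mathrm{span}(X_1,X_2)$ is tangent to $\partial\Omega$ there. The integrand of the fifth coefficient of the small-time heat content expansion, $$a_5=\frac1{240\sqrt\pi}\int_{\partial\Omega}(N^3-8N\Delta)\Delta\delta\,d\sigma ,$$ is the boundary value (limit from inside $\Omega$) of $\frac{1}{240\sqrt\pi}(N^3-8N\Delta)\Delta\delta$.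 **Theorem.** Let $\Sigma=\{z=0\}=\partial\{z>0\}$ and let $(r,\varphi,z)$ be cylindrical coordinates. 1. The origin is the only characteristic point of $\Sigma$. 2. The surface measure of $\Sigma$ is $d\sigma=\frac12 r^2\,dr\,d\varphi$. 3. Near every point of $\Sigma\setminus\{0\}$ the distance $\delta$ from $\Sigma$ is smooth on $\{z\ge 0\}$, up to $\Sigma$, and at every point of $\Sigma\setminus\{0\}$ the integrand of $a_5$ exists and equals $\dfrac{4}{15\sqrt\pi}\,r^{-4}$. 4. The integrand of $a_5$ is not integrable with respect to $\sigma$ on any neighbourhood of the origin; that is, it is not locally integrable around the characteristic point of $\Sigma$. 5. Hence the formula for $a_5$ fails for characteristic domains: there exist bounded open sets $\Omega\subset\mathbb{H}$ with smooth boundary that coincide with $\{z>0\}$ near the origin, and for every such $\Omega$ the origin is an isolated characteristic point of $\partial\Omega$ and the integrand of $a_5$ is not $\sigma$-integrable on any neighbourhood of the origin in $\partial\Omega$, so that the integral defining $a_5$ does not converge. -/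

import Mathlib

open MeasureTheory Filter Topology
open scoped ContDiff

noncomputable section

namespace HeisenbergHeat

/-- The underlying manifold `ℝ³` of the first Heisenberg group, with coordinates
`(x, y, z) = (p 0, p 1, p 2)`. -/
abbrev Heis : Type := EuclideanSpace ℝ (Fin 3)

/-- `X₁ = ∂_x - (y/2) ∂_z`. -/
def X₁ (p : Heis) : Heis := !₂[1, 0, -(p 1) / 2]

/-- `X₂ = ∂_y + (x/2) ∂_z`. -/
def X₂ (p : Heis) : Heis := !₂[0, 1, (p 0) / 2]

/-- The derivative `V f` of a function along a vector field. -/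
def lieD (V : Heis → Heis) (f : Heis → ℝ) (p : Heis) : ℝ := fderiv ℝ f p (V p)

/-- The horizontal gradient `∇f = (X₁ f) X₁ + (X₂ f) X₂`. -/
def hGrad (f : Heis → ℝ) (p : Heis) : Heis :=
  lieD X₁ f p • X₁ p + lieD X₂ f p • X₂ p

/-- The sub-Riemannian scalar product `g(∇f, ∇h)`; the frame `X₁, X₂` is orthonormal for `g`. -/
def gradInner (f h : Heis → ℝ) (p : Heis) : ℝ :=
  lieD X₁ f p * lieD X₁ h p + lieD X₂ f p * lieD X₂ h p

/-- The sub-Laplacian for Lebesgue measure. As `X₁` and `X₂` are divergence free,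
`div (∇f) = X₁ (X₁ f) + X₂ (X₂ f)`. -/
def subLaplacian (f : Heis → ℝ) (p : Heis) : ℝ :=
  lieD X₁ (lieD X₁ f) p + lieD X₂ (lieD X₂ f) p

/-- `γ` restricted to `[0, T]` is a horizontal curve with control `u`: it is absolutely continuous,
`u ∈ L²`, and `γ' = u₁ X₁(γ) + u₂ X₂(γ)` almost everywhere. -/
structure IsHorizontalCurve (T : ℝ) (γ : ℝ → Heis) (u : ℝ → EuclideanSpace ℝ (Fin 2)) : Prop where
  nonneg : 0 ≤ T
  absCont : AbsolutelyContinuousOnInterval γ 0 T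
  memLp : MemLp u 2 (volume.restrict (Set.Icc 0 T))
  hasDeriv : ∀ᵐ t ∂(volume.restrict (Set.Icc 0 T)),
    HasDerivAt γ (u t 0 • X₁ (γ t) + u t 1 • X₂ (γ t)) t

/-- The length of a horizontal curve with control `u`; since `X₁, X₂` are orthonormal, the
`g`-norm of `u₁ X₁ + u₂ X₂` is the Euclidean norm of `u`. -/
def curveLength (T : ℝ) (u : ℝ → EuclideanSpace ℝ (Fin 2)) : ℝ := ∫ t in (0 : ℝ)..T, ‖u t‖

/-- The sub-Riemannian (Carnot–Carathéodory) distance. -/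
def srDist (p q : Heis) : ℝ :=
  sInf {l : ℝ | ∃ (T : ℝ) (γ : ℝ → Heis) (u : ℝ → EuclideanSpace ℝ (Fin 2)),
    IsHorizontalCurve T γ u ∧ γ 0 = p ∧ γ T = q ∧ l = curveLength T u}

/-- The sub-Riemannian distance of `p` from a set `S`. -/
def distFrom (S : Set Heis) (p : Heis) : ℝ := sInf (srDist p '' S)

/-- The operator `N φ = 2 g(∇φ, ∇δ) + φ Δδ`. -/
def opN (δ φ : Heis → ℝ) (p : Heis) : ℝ := 2 * gradInner φ δ p + φ p * subLaplacian δ p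

/-- The function `(240 √π)⁻¹ (N³ - 8 N Δ) Δδ`. -/
def a5Expr (δ : Heis → ℝ) (p : Heis) : ℝ :=
  1 / (240 * Real.sqrt Real.pi) *
    (opN δ (opN δ (opN δ (subLaplacian δ))) p - 8 * opN δ (subLaplacian (subLaplacian δ)) p)

/-- The integrand of the heat content coefficient `a₅` of the open set `Ω`: the value at the boundary
point `p` of `(240 √π)⁻¹ (N³ - 8 N Δ) Δδ`, with `δ` the distance from `∂Ω`. As `δ` is smooth only
up to the boundary, the boundary value is the limit from inside `Ω`. -/
def a5Integrand (Ω : Set Heis) (p : Heis) : ℝ :=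
  limUnder (𝓝[Ω] p) (a5Expr (distFrom (frontier Ω)))

/-- `u` is a smooth defining function, with domain `{u > 0}` and boundary hypersurface `{u = 0}`. -/
structure IsDefiningFunction (u : Heis → ℝ) : Prop where
  smooth : ContDiff ℝ ∞ u
  regular : ∀ p, u p = 0 → fderiv ℝ u p ≠ 0

/-- `p` is a characteristic point of the hypersurface `{u = 0}`: it lies on it and the distribution
spanned by `X₁, X₂` is contained in the tangent space there. -/
def IsCharacteristic (u : Heis → ℝ) (p : Heis) : Prop :=
  u p = 0 ∧ ∀ v ∈ Submodule.span ℝ {X₁ p, X₂ p}, fderiv ℝ u p v = 0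

/-- The horizontal unit normal `∇u / ‖∇u‖_g` of the level sets of `u`. -/
def hNormal (u : Heis → ℝ) (p : Heis) : Heis := (Real.sqrt (gradInner u u p))⁻¹ • hGrad u p

/-- The Euclidean unit normal of the level sets of `u`. -/
def eNormal (u : Heis → ℝ) (p : Heis) : Heis := ‖gradient u p‖⁻¹ • gradient u p

/-- The sub-Riemannian surface measure `σ = |i_ν ω|` on `{u = 0}` induced by Lebesgue measure `ω`,
`ν` being the horizontal unit normal. On an orthonormal basis `e₁, e₂` of the tangent plane
`|ω(ν, e₁, e₂)| = |⟨ν, n⟩|`, with `n` the Euclidean unit normal, so `σ` has density `|⟨ν, n⟩|` with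
respect to the Euclidean area (the normalized two-dimensional Hausdorff measure). -/
def srSurface (u : Heis → ℝ) : Measure Heis :=
  ((Measure.euclideanHausdorffMeasure 2 : Measure Heis).restrict {p | u p = 0}).withDensity
    (fun p => ENNReal.ofReal |inner ℝ (hNormal u p) (eNormal u p)|)

/-- The defining function `u(x, y, z) = z` of the plane `Σ = {z = 0}`. -/
def zCoord (p : Heis) : ℝ := p 2

/-- The distance `r = √(x² + y²)` from the `z`-axis. -/
def cylR (p : Heis) : ℝ := Real.sqrt (p 0 ^ 2 + p 1 ^ 2)

/-- `{u > 0}` is a bounded (that is, relatively compact) open set with smooth boundary that coincides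
with the half-space `{z > 0}` near the origin. -/
def IsFlatDomain (u : Heis → ℝ) : Prop :=
  IsDefiningFunction u ∧ Bornology.IsBounded {p | 0 < u p} ∧
    ∀ᶠ p in 𝓝 (0 : Heis), (0 < u p ↔ 0 < zCoord p)

end HeisenbergHeat

end

/-! The plane is invariant under rotations about the `z`-axis and under the Heisenberg dilations, so
its distance has the form `δ = r F(s)` with `s = z / r²`. A minimizing arc projects to an arc of a
circle through the axis. If `2α` is its central angle, then `s = (α + sin α cos α) / (4 cos² α)` and
`F = α / cos α`. Writing `α = A(s)`, one finds `F' = 2 cos A` and `F - 2 s F' = -sin A`; these give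
the angular and radial parts of `∇δ`, namely `cos A` and `-sin A`, so `δ` solves the eikonal
equation.

That this model is the distance near a point of the plane off the origin (`IsArcAngle.distFrom_eq`)
is a calibration argument: a function with unit horizontal gradient varies along a curve by at most
its length, and the explicit arc attains the bound. Short curves stay near their starting point, so
only the local shape of the surface matters.

On functions `r ^ k G(s)` the operators `N` and `Δ` become ordinary differential operators in `s`,
and only the leading Taylor coefficient at `s = 0` is needed. The profile of `Δδ` vanishes to order
3 with third derivative `-64`. To leading order `N` acts as `d/ds` and `Δ` as `(1/4) d²/ds²`, so on
the plane `N³Δδ = -64 r⁻⁴` and `NΔΔδ = -16 r⁻⁴`. The integrand is therefore `(-64 + 128) / (240 √π)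
r⁻⁴ = 4 / (15 √π) r⁻⁴`.

Against `σ = (1/2) r² dr dφ` this leaves a multiple of `r⁻² dr`, which diverges at `0`. Both the
integrand and `σ` depend only on the domain near the point, so the divergence passes to every domain
that is flat near the origin. -/

noncomputable section

namespace HeisenbergHeat

/-! ### Functions of one variable vanishing to a given order -/

/-- `G` is smooth at `0`, vanishes to order `n` there, and has `n`-th derivative `c`. -/
structure VanishesTo (n : ℕ) (c : ℝ) (G : ℝ → ℝ) : Prop where
  smooth : ContDiffAt ℝ ∞ G 0
  lower : ∀ i < n, iteratedDeriv i G 0 = 0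
  top : iteratedDeriv n G 0 = c

theorem contDiffAt_deriv {G : ℝ → ℝ} {x : ℝ} (h : ContDiffAt ℝ ∞ G x) :
    ContDiffAt ℝ ∞ (deriv G) x :=
  ContDiffAt.derivWithin h (by simp)

namespace VanishesTo

variable {n : ℕ} {c d : ℝ} {G K b : ℝ → ℝ}

theorem congr (h : VanishesTo n c G) (e : K =ᶠ[𝓝 0] G) : VanishesTo n c K where
  smooth := h.smooth.congr_of_eventuallyEq e
  lower i hi := by rw [e.iteratedDeriv_eq]; exact h.lower i hi
  top := by rw [e.iteratedDeriv_eq]; exact h.top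

theorem deriv (h : VanishesTo (n + 1) c G) : VanishesTo n c (deriv G) where
  smooth := contDiffAt_deriv h.smooth
  lower i hi := by rw [← iteratedDeriv_succ']; exact h.lower _ (by omega)
  top := by rw [← iteratedDeriv_succ']; exact h.top

theorem of_deriv (hG : ContDiffAt ℝ ∞ G 0) (h0 : G 0 = 0) (h : VanishesTo n c (_root_.deriv G)) :
    VanishesTo (n + 1) c G where
  smooth := hG
  lower i hi := by
    cases i with
    | zero => simpa using h0
    | succ i => rw [iteratedDeriv_succ']; exact h.lower i (by omega)
  top := by rw [iteratedDeriv_succ']; exact h.top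

theorem drop (h : VanishesTo (n + 1) c G) : VanishesTo n 0 G where
  smooth := h.smooth
  lower i hi := h.lower i (by omega)
  top := h.lower n (by omega)

theorem value (h : VanishesTo 0 c G) : G 0 = c := by simpa using h.top

theorem of_value (hG : ContDiffAt ℝ ∞ G 0) : VanishesTo 0 (G 0) G where
  smooth := hG
  lower i hi := by omega
  top := by simp

/-- In the Leibniz rule every term except `G⁽ⁿ⁾ b` contains a derivative of `G` of order below `n`,
so a smooth factor enters the leading coefficient only through its value at `0`. -/
theorem mul (h : VanishesTo n c G) (hb : ContDiffAt ℝ ∞ b 0) :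
    VanishesTo n (c * b 0) (fun s => G s * b s) where
  smooth := h.smooth.mul hb
  lower i hi := by
    have := iteratedDeriv_mul (n := i) (h.smooth.of_le (mod_cast le_top))
      (hb.of_le (mod_cast le_top))
    refine this.trans (Finset.sum_eq_zero fun j hj => ?_)
    rw [h.lower j (by have := Finset.mem_range.1 hj; omega)]; ring
  top := by
    have := iteratedDeriv_mul (n := n) (h.smooth.of_le (mod_cast le_top))
      (hb.of_le (mod_cast le_top))
    refine this.trans ?_
    rw [Finset.sum_range_succ, Finset.sum_eq_zero fun j hj => ?_]
    · simp [h.top]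
    · rw [h.lower j (by have := Finset.mem_range.1 hj; omega)]; ring

theorem add (h : VanishesTo n c G) (k : VanishesTo n d K) :
    VanishesTo n (c + d) (fun s => G s + K s) where
  smooth := h.smooth.add k.smooth
  lower i hi := by
    have := iteratedDeriv_add (n := i) (h.smooth.of_le (mod_cast le_top))
      (k.smooth.of_le (mod_cast le_top))
    refine this.trans ?_
    rw [h.lower i hi, k.lower i hi, add_zero]
  top := by
    have := iteratedDeriv_add (n := n) (h.smooth.of_le (mod_cast le_top))
      (k.smooth.of_le (mod_cast le_top))
    refine this.trans ?_
    rw [h.top, k.top]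

end VanishesTo

/-! ### The angle of the minimizing arcs -/

/-- `A s` is the half angle of the minimizing arc from a point with `z = s r²` to the plane: it
inverts `α ↦ (α + sin α cos α) / (4 cos² α)` on the neighbourhood `W` of `0`. -/
structure IsArcAngle (W : Set ℝ) (A : ℝ → ℝ) : Prop where
  isOpen : IsOpen W
  zero_mem : 0 ∈ W
  map_zero : A 0 = 0
  smooth : ContDiffOn ℝ ∞ A W
  cos_pos : ∀ s ∈ W, 0 < Real.cos (A s)
  den_pos : ∀ s ∈ W, 0 < Real.cos (A s) + A s * Real.sin (A s)
  eqn : ∀ s ∈ W, A s + Real.sin (A s) * Real.cos (A s) = 4 * s * Real.cos (A s) ^ 2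
  hasDerivAt : ∀ s ∈ W,
    HasDerivAt A (2 * Real.cos (A s) ^ 3 / (Real.cos (A s) + A s * Real.sin (A s))) s
  nonneg : ∀ s ∈ W, 0 ≤ s → 0 ≤ A s

/-- Inverse function theorem at `0`: the map has derivative `(cos a + a sin a) / (2 cos³ a)`, which
is positive for `|a| < 1`. -/
theorem exists_isArcAngle : ∃ W A, IsArcAngle W A := by
  set m : ℝ → ℝ := fun a => (a + Real.sin a * Real.cos a) / (4 * Real.cos a ^ 2) with hm
  have hcos : ∀ a : ℝ, |a| < 1 → 0 < Real.cos a := fun a ha =>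
    Real.cos_pos_of_mem_Ioo ⟨by have := Real.pi_gt_three; have := (abs_lt.1 ha).1; linarith,
      by have := Real.pi_gt_three; have := (abs_lt.1 ha).2; linarith⟩
  have hasin : ∀ a : ℝ, |a| < 1 → 0 ≤ a * Real.sin a := by
    intro a ha
    have hpi := Real.pi_gt_three
    obtain ⟨h1, h2⟩ := abs_lt.1 ha
    rcases le_total 0 a with h | h
    · exact mul_nonneg h (Real.sin_nonneg_of_nonneg_of_le_pi h (by linarith))
    · exact mul_nonneg_of_nonpos_of_nonpos h
        (Real.sin_nonpos_of_nonpos_of_neg_pi_le h (by linarith))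
  have hder : ∀ a : ℝ, |a| < 1 →
      HasDerivAt m ((Real.cos a + a * Real.sin a) / (2 * Real.cos a ^ 3)) a := by
    intro a ha
    have hc := (hcos a ha).ne'
    have h1 := ((hasDerivAt_id a).add ((Real.hasDerivAt_sin a).mul (Real.hasDerivAt_cos a))).div
      (((Real.hasDerivAt_cos a).pow 2).const_mul 4) (by simpa using hc)
    refine h1.congr_deriv ?_
    have hs : Real.sin a ^ 2 = 1 - Real.cos a ^ 2 := Real.sin_sq a
    simp
    field_simp
    linear_combination (2 * Real.cos a) * hs
  have hsm : ∀ a : ℝ, |a| < 1 → ContDiffAt ℝ ∞ m a := by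
    intro a ha
    have hc := (hcos a ha).ne'
    exact ContDiffAt.div (by fun_prop) (by fun_prop) (by positivity)
  have hpos : ∀ a : ℝ, |a| < 1 → (Real.cos a + a * Real.sin a) / (2 * Real.cos a ^ 3) ≠ 0 := by
    intro a ha
    have := hcos a ha
    have := hasin a ha
    positivity
  have h00 : |(0 : ℝ)| < 1 := by simp
  have hf := (hder 0 h00).hasFDerivAt_equiv (hpos 0 h00)
  set e := (hsm 0 h00).toOpenPartialHomeomorph m hf (by simp) with he
  have hecoe : (e : ℝ → ℝ) = m := rfl
  have h0s : (0 : ℝ) ∈ e.source := ContDiffAt.mem_toOpenPartialHomeomorph_source _ _ _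
  have hm0 : m 0 = 0 := by simp [hm]
  have h0t : (0 : ℝ) ∈ e.target := by
    have := e.map_source h0s
    rwa [hecoe, hm0] at this
  have hA0 : e.symm 0 = 0 := by
    have := e.left_inv h0s
    rwa [hecoe, hm0] at this
  -- Keeping the angle below `1` in absolute value ensures `cos > 0` and `a sin a ≥ 0` on all of
  -- `W`.
  set W : Set ℝ := e.target ∩ e.symm ⁻¹' {a | |a| < 1} with hW
  have hsW : ∀ s ∈ W, |e.symm s| < 1 := fun s hs => hs.2
  have hright : ∀ s ∈ W, m (e.symm s) = s := fun s hs => e.right_inv hs.1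
  have heqn : ∀ s ∈ W, e.symm s + Real.sin (e.symm s) * Real.cos (e.symm s) =
      4 * s * Real.cos (e.symm s) ^ 2 := by
    intro s hs
    have h1 := hright s hs
    have hc := (hcos _ (hsW s hs)).ne'
    simp only [hm] at h1
    rw [div_eq_iff (by positivity)] at h1
    linarith
  refine ⟨W, e.symm, ?_, ⟨h0t, by simp [hA0]⟩, hA0, ?_, fun s hs => hcos _ (hsW s hs), ?_, heqn,
    ?_, ?_⟩
  · exact e.symm.isOpen_inter_preimage (isOpen_lt continuous_abs continuous_const)
  · intro s hs
    exact (e.contDiffAt_symm_deriv (hpos _ (hsW s hs)) hs.1 (hder _ (hsW s hs))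
      (hsm _ (hsW s hs))).contDiffWithinAt
  · intro s hs
    have := hcos _ (hsW s hs)
    have := hasin _ (hsW s hs)
    positivity
  · intro s hs
    have := e.hasDerivAt_symm hs.1 (hpos _ (hsW s hs)) (hder _ (hsW s hs))
    rwa [inv_div] at this
  · intro s hs h
    by_contra hneg
    push Not at hneg
    have h1 := heqn s hs
    have hc := hcos _ (hsW s hs)
    have h2 : 0 ≤ 4 * s * Real.cos (e.symm s) ^ 2 := by positivity
    have h3 : Real.sin (e.symm s) < 0 := Real.sin_neg_of_neg_of_neg_pi_lt hneg
      (by have := Real.pi_gt_three; have := (abs_lt.1 (hsW s hs)).1; linarith)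
    nlinarith [mul_neg_of_neg_of_pos h3 hc]

namespace IsArcAngle

variable {W : Set ℝ} {A : ℝ → ℝ}

theorem mem_nhds (h : IsArcAngle W A) {s : ℝ} (hs : s ∈ W) : W ∈ 𝓝 s := h.isOpen.mem_nhds hs

theorem contDiffAt (h : IsArcAngle W A) {s : ℝ} (hs : s ∈ W) : ContDiffAt ℝ ∞ A s :=
  h.smooth.contDiffAt (h.mem_nhds hs)

/-- The profile of the distance from the plane: `δ = r F(z / r²)` with `F = A / cos A`. -/
def profile (A : ℝ → ℝ) (s : ℝ) : ℝ := A s / Real.cos (A s)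

theorem profile_hasDerivAt (h : IsArcAngle W A) {s : ℝ} (hs : s ∈ W) :
    HasDerivAt (profile A) (2 * Real.cos (A s)) s := by
  have hc := (h.cos_pos s hs).ne'
  have hd := (h.den_pos s hs).ne'
  have hA := h.hasDerivAt s hs
  refine (hA.div hA.cos hc).congr_deriv ?_
  field_simp
  ring

/-- The left side is the radial derivative of `r F(z / r²)`; the equation defining `A` reduces it to
`-sin A`. -/
theorem profile_euler (h : IsArcAngle W A) {s : ℝ} (hs : s ∈ W) :
    profile A s - 2 * s * (2 * Real.cos (A s)) = -Real.sin (A s) := by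
  have hc := (h.cos_pos s hs).ne'
  have := h.eqn s hs
  unfold profile
  field_simp
  linear_combination this

/-- The profile of `Δδ = r⁻¹ G(z / r²)`. -/
def lapProfile (A : ℝ → ℝ) (s : ℝ) : ℝ :=
  (A s * Real.cos (2 * A s) - Real.sin (2 * A s) / 2) *
    (Real.cos (A s) + A s * Real.sin (A s))⁻¹

theorem lapProfile_contDiffAt (h : IsArcAngle W A) {s : ℝ} (hs : s ∈ W) :
    ContDiffAt ℝ ∞ (lapProfile A) s := by
  have hA := h.contDiffAt hs
  have hd := (h.den_pos s hs).ne'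
  unfold lapProfile
  refine ContDiffAt.mul (by fun_prop) (ContDiffAt.inv (by fun_prop) hd)

theorem profile_contDiffAt (h : IsArcAngle W A) {s : ℝ} (hs : s ∈ W) :
    ContDiffAt ℝ ∞ (profile A) s := by
  have hA := h.contDiffAt hs
  exact ContDiffAt.div hA (by fun_prop) (h.cos_pos s hs).ne'

/-- The numerator `A cos 2A - (sin 2A) / 2` has derivative `-2 A' A sin 2A`. Since `A ≈ 2s`, this is
`-32 s²` to leading order, hence third derivative `-64`; the denominator equals `1` at `0`. -/
theorem lapProfile_vanishesTo (h : IsArcAngle W A) : VanishesTo 3 (-64) (lapProfile A) := by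
  have hA := h.contDiffAt h.zero_mem
  have hA' := contDiffAt_deriv hA
  have h0 := h.map_zero
  have hA1 : deriv A 0 = 2 := by simpa [h0] using (h.hasDerivAt 0 h.zero_mem).deriv
  have hdiff : ∀ᶠ s in 𝓝 (0 : ℝ), HasDerivAt A (deriv A s) s := by
    filter_upwards [h.mem_nhds h.zero_mem] with s hs
    exact (h.contDiffAt hs).differentiableAt (by simp) |>.hasDerivAt
  have hC : VanishesTo 1 8 (fun s => Real.sin (2 * A s) + 2 * A s * Real.cos (2 * A s)) := by
    refine .of_deriv (by fun_prop) (by simp [h0]) ?_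
    have hd : deriv (fun s => Real.sin (2 * A s) + 2 * A s * Real.cos (2 * A s)) =ᶠ[𝓝 0]
        fun s => (4 * Real.cos (2 * A s) - 4 * A s * Real.sin (2 * A s)) * deriv A s := by
      filter_upwards [hdiff] with s hs
      have h2 := hs.const_mul 2
      refine ((h2.sin).add (h2.mul h2.cos)).deriv.trans ?_
      ring
    have := VanishesTo.of_value
      (G := fun s => (4 * Real.cos (2 * A s) - 4 * A s * Real.sin (2 * A s)) * deriv A s)
      (by fun_prop)
    simp only [h0, hA1] at this
    norm_num at this
    exact this.congr hd
  have hB : VanishesTo 2 16 (fun s => A s * Real.sin (2 * A s)) := by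
    refine .of_deriv (by fun_prop) (by simp [h0]) ?_
    have hd : deriv (fun s => A s * Real.sin (2 * A s)) =ᶠ[𝓝 0]
        fun s => (Real.sin (2 * A s) + 2 * A s * Real.cos (2 * A s)) * deriv A s := by
      filter_upwards [hdiff] with s hs
      have h2 := hs.const_mul 2
      refine (hs.mul h2.sin).deriv.trans ?_
      ring
    have := hC.mul hA'
    rw [hA1] at this
    norm_num at this
    exact this.congr hd
  have hK : VanishesTo 3 (-64) (fun s => A s * Real.cos (2 * A s) - Real.sin (2 * A s) / 2) := by
    refine .of_deriv (by fun_prop) (by simp [h0]) ?_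
    have hd : deriv (fun s => A s * Real.cos (2 * A s) - Real.sin (2 * A s) / 2) =ᶠ[𝓝 0]
        fun s => (A s * Real.sin (2 * A s)) * (-2 * deriv A s) := by
      filter_upwards [hdiff] with s hs
      have h2 := hs.const_mul 2
      refine ((hs.mul h2.cos).sub (h2.sin.div_const 2)).deriv.trans ?_
      ring
    have := hB.mul (b := fun s => -2 * deriv A s) (by fun_prop)
    rw [hA1] at this
    norm_num at this
    refine this.congr (hd.trans (.of_eq ?_))
    ext s; ring
  have := hK.mul (b := fun s => (Real.cos (A s) + A s * Real.sin (A s))⁻¹)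
    (ContDiffAt.inv (by fun_prop) (h.den_pos 0 h.zero_mem).ne')
  simp only [h0, Real.cos_zero, zero_mul, add_zero, inv_one, mul_one] at this
  exact this

end IsArcAngle

/-! ### Differential operators on homogeneous, rotation invariant functions -/

/-- The operators are local. Equality on an open set, unlike equality at a point, survives
differentiation, so the iterated operators can be rewritten one at a time. -/
theorem lieD_eqOn {V : Heis → Heis} {f h : Heis → ℝ} {U : Set Heis} (hU : IsOpen U)
    (e : Set.EqOn f h U) : Set.EqOn (lieD V f) (lieD V h) U := fun p hp => by
  unfold lieD
  rw [(e.eventuallyEq_of_mem (hU.mem_nhds hp)).fderiv_eq]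

theorem subLaplacian_eqOn {f h : Heis → ℝ} {U : Set Heis} (hU : IsOpen U)
    (e : Set.EqOn f h U) : Set.EqOn (subLaplacian f) (subLaplacian h) U := fun p hp => by
  unfold subLaplacian
  rw [lieD_eqOn hU (lieD_eqOn hU e) hp, lieD_eqOn hU (lieD_eqOn hU e) hp]

theorem opN_eqOn {δ δ' f h : Heis → ℝ} {U : Set Heis} (hU : IsOpen U) (d : Set.EqOn δ δ' U)
    (e : Set.EqOn f h U) : Set.EqOn (opN δ f) (opN δ' h) U := fun p hp => by
  unfold opN gradInner
  rw [lieD_eqOn hU e hp, lieD_eqOn hU e hp, lieD_eqOn hU d hp, lieD_eqOn hU d hp, e hp,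
    subLaplacian_eqOn hU d hp]

theorem a5Expr_eqOn {δ δ' : Heis → ℝ} {U : Set Heis} (hU : IsOpen U) (d : Set.EqOn δ δ' U) :
    Set.EqOn (a5Expr δ) (a5Expr δ') U := fun p hp => by
  have hΔ := subLaplacian_eqOn hU d
  unfold a5Expr
  rw [opN_eqOn hU d (opN_eqOn hU d (opN_eqOn hU d hΔ)) hp,
    opN_eqOn hU d (subLaplacian_eqOn hU hΔ) hp]

/-! ### Functions of the cylindrical radius and of `z / r²` -/

theorem cylR_sq (p : Heis) : cylR p ^ 2 = p 0 ^ 2 + p 1 ^ 2 := Real.sq_sqrt (by positivity)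

theorem continuous_cylR : Continuous cylR := by unfold cylR; fun_prop

theorem cylR_nonneg (p : Heis) : 0 ≤ cylR p := Real.sqrt_nonneg _

theorem contDiffAt_cylR {p : Heis} (hp : 0 < cylR p) : ContDiffAt ℝ ∞ cylR p := by
  have h : p 0 ^ 2 + p 1 ^ 2 ≠ 0 := by rw [← cylR_sq]; positivity
  exact ContDiffAt.sqrt (by fun_prop) h

/-- The function `r ^ k * G (z / r²)`, homogeneous of degree `k` for the Heisenberg dilations. -/
def hom (k : ℤ) (G : ℝ → ℝ) (p : Heis) : ℝ := cylR p ^ k * G (p 2 / cylR p ^ 2)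

/-- The points off the `z`-axis with `z / r² ∈ W`. -/
def cone (W : Set ℝ) : Set Heis := {p | 0 < cylR p ∧ p 2 / cylR p ^ 2 ∈ W}

theorem continuousAt_slope {p : Heis} (hp : 0 < cylR p) :
    ContinuousAt (fun q : Heis => q 2 / cylR q ^ 2) p :=
  ContinuousAt.div (by fun_prop) (continuous_cylR.continuousAt.pow 2) (by positivity)

theorem isOpen_cone {W : Set ℝ} (hW : IsOpen W) : IsOpen (cone W) := by
  rw [isOpen_iff_mem_nhds]
  rintro p ⟨h1, h2⟩
  have a1 : ∀ᶠ q in 𝓝 p, 0 < cylR q :=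
    continuous_cylR.continuousAt.eventually (isOpen_Ioi.mem_nhds h1)
  have a2 : ∀ᶠ q in 𝓝 p, q 2 / cylR q ^ 2 ∈ W :=
    (continuousAt_slope h1).eventually (hW.mem_nhds h2)
  filter_upwards [a1, a2] with q b1 b2 using ⟨b1, b2⟩

theorem hom_contDiffAt {k : ℤ} {G : ℝ → ℝ} {p : Heis} (hp : 0 < cylR p)
    (hG : ContDiffAt ℝ ∞ G (p 2 / cylR p ^ 2)) : ContDiffAt ℝ ∞ (hom k G) p := by
  have hr := contDiffAt_cylR hp
  have hs : ContDiffAt ℝ ∞ (fun q : Heis => q 2 / cylR q ^ 2) p :=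
    ContDiffAt.div (by fun_prop) (hr.pow 2) (by positivity)
  have hk : ContDiffAt ℝ ∞ (fun q : Heis => cylR q ^ k) p := by
    rcases k with n | n
    · simpa using! hr.pow n
    · simp only [zpow_negSucc]
      exact (hr.pow (n + 1)).inv (by positivity)
  exact hk.mul (hG.comp p hs)

theorem hom_continuousAt {k : ℤ} {G : ℝ → ℝ} {p : Heis} (hp : 0 < cylR p)
    (hG : ContinuousAt G (p 2 / cylR p ^ 2)) : ContinuousAt (hom k G) p := by
  refine ContinuousAt.mul (continuous_cylR.continuousAt.zpow₀ k (.inl hp.ne')) ?_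
  exact ContinuousAt.comp (f := fun q : Heis => q 2 / cylR q ^ 2) hG (continuousAt_slope hp)

theorem hom_eqOn {k : ℤ} {G K : ℝ → ℝ} {W : Set ℝ} (h : Set.EqOn G K W) :
    Set.EqOn (hom k G) (hom k K) (cone W) := fun p hp => by
  unfold hom; rw [h hp.2]

theorem fderiv_eq_of_hasDerivAt_line {f : Heis → ℝ} {p v : Heis} {d : ℝ}
    (hf : DifferentiableAt ℝ f p) (h : HasDerivAt (fun t : ℝ => f (p + t • v)) d 0) :
    fderiv ℝ f p v = d := by
  rw [← hf.lineDeriv_eq_fderiv]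
  exact h.deriv

theorem fderiv_hom {k : ℤ} {G : ℝ → ℝ} {p : Heis} (hp : 0 < cylR p)
    (hG : ContDiffAt ℝ ∞ G (p 2 / cylR p ^ 2)) (v : Heis) :
    fderiv ℝ (hom k G) p v =
      (p 0 * v 0 + p 1 * v 1) * hom (k - 2) (fun s => k * G s - 2 * s * deriv G s) p +
        v 2 * hom (k - 2) (deriv G) p := by
  refine fderiv_eq_of_hasDerivAt_line ((hom_contDiffAt hp hG).differentiableAt (by simp)) ?_
  have hline : ∀ i, HasDerivAt (fun t : ℝ => (p + t • v) i) (v i) 0 := by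
    intro i
    simpa using ((hasDerivAt_id (0 : ℝ)).mul_const (v i)).const_add (p i)
  have hρ : (p + (0 : ℝ) • v) 0 ^ 2 + (p + (0 : ℝ) • v) 1 ^ 2 ≠ 0 := by
    simp only [zero_smul, add_zero]; rw [← cylR_sq]; positivity
  have hr : HasDerivAt (fun t : ℝ => cylR (p + t • v)) ((p 0 * v 0 + p 1 * v 1) / cylR p) 0 := by
    refine ((((hline 0).pow 2).add ((hline 1).pow 2)).sqrt hρ).congr_deriv ?_
    have : Real.sqrt (p 0 ^ 2 + p 1 ^ 2) = cylR p := rfl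
    simp [this]
    field_simp
  have hs : HasDerivAt (fun t : ℝ => (p + t • v) 2 / cylR (p + t • v) ^ 2)
      ((v 2 - 2 * (p 2 / cylR p ^ 2) * (p 0 * v 0 + p 1 * v 1)) / cylR p ^ 2) 0 := by
    refine ((hline 2).div (hr.pow 2) (by simp; positivity)).congr_deriv ?_
    simp
    field_simp
  have hk : HasDerivAt (fun t : ℝ => cylR (p + t • v) ^ k)
      (k * cylR p ^ (k - 1) * ((p 0 * v 0 + p 1 * v 1) / cylR p)) 0 := by
    have := (hasDerivAt_zpow k (cylR (p + (0 : ℝ) • v)) (.inl (by simpa using hp.ne'))).comp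
      (0 : ℝ) hr
    simpa using! this
  have hGd : HasDerivAt G (deriv G (p 2 / cylR p ^ 2))
      ((p + (0 : ℝ) • v) 2 / cylR (p + (0 : ℝ) • v) ^ 2) := by
    simpa using (hG.differentiableAt (by simp)).hasDerivAt
  have hGs := hGd.comp (0 : ℝ) hs
  refine (hk.mul hGs).congr_deriv ?_
  have hne := hp.ne'
  simp only [hom, zero_smul, add_zero, Function.comp_apply]
  have e1 : cylR p ^ k = cylR p ^ (k - 2) * cylR p ^ 2 := by
    rw [← zpow_natCast, ← zpow_add₀ hne]; congr 1; push_cast; ring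
  have e2 : cylR p ^ (k - 1) = cylR p ^ (k - 2) * cylR p := by
    rw [← zpow_add_one₀ hne]; congr 1; ring
  rw [e1, e2]
  field_simp
  ring

theorem lieD_X₁_hom {k : ℤ} {G : ℝ → ℝ} {p : Heis} (hp : 0 < cylR p)
    (hG : ContDiffAt ℝ ∞ G (p 2 / cylR p ^ 2)) :
    lieD X₁ (hom k G) p = p 0 * hom (k - 2) (fun s => k * G s - 2 * s * deriv G s) p -
      p 1 / 2 * hom (k - 2) (deriv G) p := by
  unfold lieD
  rw [fderiv_hom hp hG]
  simp [X₁]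
  ring

theorem lieD_X₂_hom {k : ℤ} {G : ℝ → ℝ} {p : Heis} (hp : 0 < cylR p)
    (hG : ContDiffAt ℝ ∞ G (p 2 / cylR p ^ 2)) :
    lieD X₂ (hom k G) p = p 1 * hom (k - 2) (fun s => k * G s - 2 * s * deriv G s) p +
      p 0 / 2 * hom (k - 2) (deriv G) p := by
  unfold lieD
  rw [fderiv_hom hp hG]
  simp [X₂]

theorem gradInner_hom {k l : ℤ} {G K : ℝ → ℝ} {p : Heis} (hp : 0 < cylR p)
    (hG : ContDiffAt ℝ ∞ G (p 2 / cylR p ^ 2)) (hK : ContDiffAt ℝ ∞ K (p 2 / cylR p ^ 2)) :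
    gradInner (hom k G) (hom l K) p = hom (k + l - 2) (fun s =>
      (k * G s - 2 * s * deriv G s) * (l * K s - 2 * s * deriv K s) + deriv G s * deriv K s / 4)
      p := by
  unfold gradInner
  rw [lieD_X₁_hom hp hG, lieD_X₂_hom hp hG, lieD_X₁_hom hp hK, lieD_X₂_hom hp hK]
  simp only [hom]
  have e : cylR p ^ (k + l - 2) = cylR p ^ (k - 2) * cylR p ^ (l - 2) * cylR p ^ 2 := by
    rw [← zpow_natCast, ← zpow_add₀ hp.ne', ← zpow_add₀ hp.ne']; congr 1; push_cast; ring
  rw [e, cylR_sq]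
  ring

theorem lieD_mul {V : Heis → Heis} {f h : Heis → ℝ} {p : Heis} (hf : DifferentiableAt ℝ f p)
    (hh : DifferentiableAt ℝ h p) :
    lieD V (fun q => f q * h q) p = lieD V f p * h p + f p * lieD V h p := by
  unfold lieD
  rw [fderiv_fun_mul hf hh]
  simp
  ring

theorem lieD_coord (V : Heis → Heis) (i : Fin 3) (p : Heis) :
    lieD V (fun q => q i) p = V p i := by
  have : HasFDerivAt (fun q : Heis => q i) (EuclideanSpace.proj i : Heis →L[ℝ] ℝ) p :=
    (EuclideanSpace.proj i : Heis →L[ℝ] ℝ).hasFDerivAt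
  unfold lieD
  rw [this.fderiv]
  simp

/-- The action of `Δ` on the profiles of functions that are homogeneous of degree `k`. -/
def lapOp (k : ℤ) (G : ℝ → ℝ) (s : ℝ) : ℝ :=
  G s * k ^ 2 + deriv G s * (4 * (1 - k) * s) + deriv (deriv G) s * (4 * s ^ 2 + 1 / 4)

theorem lieD_coord_mul_hom {V : Heis → Heis} {k : ℤ} {G : ℝ → ℝ} {p : Heis} (i : Fin 3)
    (hp : 0 < cylR p) (hG : ContDiffAt ℝ ∞ G (p 2 / cylR p ^ 2)) :
    lieD V (fun q => q i * hom k G q) p = V p i * hom k G p + p i * lieD V (hom k G) p := by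
  rw [lieD_mul (by fun_prop) ((hom_contDiffAt hp hG).differentiableAt (by simp)), lieD_coord]

theorem lieD_comb {V : Heis → Heis} {k l : ℤ} {G K : ℝ → ℝ} {p : Heis} (i j : Fin 3) (c : ℝ)
    (hp : 0 < cylR p) (hG : ContDiffAt ℝ ∞ G (p 2 / cylR p ^ 2))
    (hK : ContDiffAt ℝ ∞ K (p 2 / cylR p ^ 2)) :
    lieD V (fun q => q i * hom k G q + c * (q j * hom l K q)) p =
      V p i * hom k G p + p i * lieD V (hom k G) p +
        c * (V p j * hom l K p + p j * lieD V (hom l K) p) := by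
  have dG := (hom_contDiffAt (k := k) hp hG).differentiableAt (by simp)
  have dK := (hom_contDiffAt (k := l) hp hK).differentiableAt (by simp)
  rw [← lieD_coord_mul_hom i hp hG, ← lieD_coord_mul_hom j hp hK]
  unfold lieD
  rw [fderiv_fun_add (by fun_prop) (by fun_prop), fderiv_const_mul (by fun_prop)]
  simp

theorem subLaplacian_hom {k : ℤ} {G : ℝ → ℝ} {W : Set ℝ} (hW : IsOpen W)
    (hG : ∀ s ∈ W, ContDiffAt ℝ ∞ G s) :
    Set.EqOn (subLaplacian (hom k G)) (hom (k - 2) (lapOp k G)) (cone W) := by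
  intro p hp
  set P : ℝ → ℝ := fun s => k * G s - 2 * s * deriv G s with hP
  have hG' : ∀ s ∈ W, ContDiffAt ℝ ∞ (deriv G) s := fun s hs => contDiffAt_deriv (hG s hs)
  have hPs : ∀ s ∈ W, ContDiffAt ℝ ∞ P s := by
    intro s hs
    have := hG s hs
    have := hG' s hs
    fun_prop
  -- The first derivatives are coordinates times homogeneous functions, so the product rule and the
  -- first-order formulas can be applied a second time.
  have e1 : Set.EqOn (lieD X₁ (hom k G))
      (fun q => q 0 * hom (k - 2) P q + (-1 / 2) * (q 1 * hom (k - 2) (deriv G) q)) (cone W) := by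
    intro q hq
    rw [lieD_X₁_hom hq.1 (hG _ hq.2)]; ring
  have e2 : Set.EqOn (lieD X₂ (hom k G))
      (fun q => q 1 * hom (k - 2) P q + (1 / 2) * (q 0 * hom (k - 2) (deriv G) q)) (cone W) := by
    intro q hq
    rw [lieD_X₂_hom hq.1 (hG _ hq.2)]; ring
  have hs := hp.2
  have dP : deriv P (p 2 / cylR p ^ 2) = (k - 2) * deriv G (p 2 / cylR p ^ 2) -
      2 * (p 2 / cylR p ^ 2) * deriv (deriv G) (p 2 / cylR p ^ 2) := by
    have d1 := ((hG _ hs).differentiableAt (by simp)).hasDerivAt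
    have d2 := ((hG' _ hs).differentiableAt (by simp)).hasDerivAt
    refine ((d1.const_mul (k : ℝ)).sub
      (((hasDerivAt_id (p 2 / cylR p ^ 2)).const_mul 2).mul d2)).deriv.trans ?_
    simp
    ring
  unfold subLaplacian
  rw [lieD_eqOn (isOpen_cone hW) e1 hp, lieD_eqOn (isOpen_cone hW) e2 hp,
    lieD_comb 0 1 _ hp.1 (hPs _ hs) (hG' _ hs), lieD_comb 1 0 _ hp.1 (hPs _ hs) (hG' _ hs),
    lieD_X₁_hom hp.1 (hPs _ hs), lieD_X₁_hom hp.1 (hG' _ hs),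
    lieD_X₂_hom hp.1 (hPs _ hs), lieD_X₂_hom hp.1 (hG' _ hs)]
  have e : cylR p ^ (k - 2) = cylR p ^ (k - 2 - 2) * cylR p ^ 2 := by
    rw [← zpow_natCast, ← zpow_add₀ hp.1.ne']; congr 1; push_cast; ring
  simp only [hom, dP, lapOp]
  rw [e]
  set s := p 2 / cylR p ^ 2
  set R := cylR p ^ (k - 2 - 2)
  rw [cylR_sq]
  simp [X₁, X₂, hP]
  ring

/-! ### The expression of `a₅` for the model distance -/

namespace IsArcAngle

variable {W : Set ℝ} {A : ℝ → ℝ}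

theorem deriv_profile_eqOn (h : IsArcAngle W A) :
    Set.EqOn (deriv (profile A)) (fun s => 2 * Real.cos (A s)) W := fun _ hs =>
  (h.profile_hasDerivAt hs).deriv

/-- Expressing `s` through the angle by the defining equation turns the claim into a trigonometric
identity in one variable. -/
theorem lapOp_profile (h : IsArcAngle W A) : Set.EqOn (lapOp 1 (profile A)) (lapProfile A) W := by
  intro s hs
  have d1 := h.deriv_profile_eqOn hs
  have d2 : deriv (deriv (profile A)) s = -2 * Real.sin (A s) *
      (2 * Real.cos (A s) ^ 3 / (Real.cos (A s) + A s * Real.sin (A s))) := by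
    rw [(h.deriv_profile_eqOn.eventuallyEq_of_mem (h.mem_nhds hs)).deriv_eq]
    refine ((h.hasDerivAt s hs).cos.const_mul 2).deriv.trans ?_
    ring
  have hc := (h.cos_pos s hs).ne'
  have hd := (h.den_pos s hs).ne'
  have hs4 : s = (A s + Real.sin (A s) * Real.cos (A s)) / (4 * Real.cos (A s) ^ 2) := by
    rw [h.eqn s hs]; field_simp
  unfold lapOp lapProfile
  rw [d1, d2, Real.cos_two_mul, Real.sin_two_mul]
  have hsin : Real.sin (A s) ^ 2 = 1 - Real.cos (A s) ^ 2 := Real.sin_sq _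
  unfold profile
  generalize A s = a at *
  subst hs4
  push_cast
  field_simp
  ring_nf
  rw [show Real.sin a ^ 3 = Real.sin a * Real.sin a ^ 2 by ring, hsin]
  ring

theorem subLaplacian_dist (h : IsArcAngle W A) :
    Set.EqOn (subLaplacian (hom 1 (profile A))) (hom (-1) (lapProfile A)) (cone W) := by
  intro p hp
  rw [subLaplacian_hom h.isOpen (fun s hs => h.profile_contDiffAt hs) hp]
  exact hom_eqOn h.lapOp_profile hp

/-- The eikonal equation: the radial and angular components of the gradient are `-sin A` and `cos
A`. -/
theorem gradInner_dist (h : IsArcAngle W A) {p : Heis} (hp : p ∈ cone W) :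
    gradInner (hom 1 (profile A)) (hom 1 (profile A)) p = 1 := by
  have hF := h.profile_contDiffAt hp.2
  rw [gradInner_hom hp.1 hF hF]
  have d1 := h.deriv_profile_eqOn hp.2
  have e := h.profile_euler hp.2
  simp only [hom] at *
  rw [d1]
  push_cast
  rw [one_mul, e]
  have := Real.sin_sq_add_cos_sq (A (p 2 / cylR p ^ 2))
  norm_num
  linear_combination this

/-- The action of `N` on the profiles of functions that are homogeneous of degree `k`. -/
def nOp (A : ℝ → ℝ) (k : ℤ) (G : ℝ → ℝ) (s : ℝ) : ℝ :=
  deriv G s * (Real.cos (A s) + 4 * s * Real.sin (A s)) +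
    G s * (lapProfile A s - 2 * k * Real.sin (A s))

theorem opN_hom (h : IsArcAngle W A) {k : ℤ} {G : ℝ → ℝ} (hG : ∀ s ∈ W, ContDiffAt ℝ ∞ G s) :
    Set.EqOn (opN (hom 1 (profile A)) (hom k G)) (hom (k - 1) (nOp A k G)) (cone W) := by
  intro p hp
  unfold opN
  rw [gradInner_hom hp.1 (hG _ hp.2) (h.profile_contDiffAt hp.2), h.subLaplacian_dist hp]
  have d1 := h.deriv_profile_eqOn hp.2
  have e := h.profile_euler hp.2
  simp only [hom, nOp] at *
  have e1 : cylR p ^ (k - 1) = cylR p ^ k * cylR p ^ (-1 : ℤ) := by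
    rw [← zpow_add₀ hp.1.ne']; congr 1
  rw [d1, show k + 1 - 2 = k - 1 by ring, e1]
  push_cast
  rw [one_mul, e]
  ring

theorem nOp_contDiffAt (h : IsArcAngle W A) {k : ℤ} {G : ℝ → ℝ}
    (hG : ∀ s ∈ W, ContDiffAt ℝ ∞ G s) : ∀ s ∈ W, ContDiffAt ℝ ∞ (nOp A k G) s := by
  intro s hs
  have h1 := hG s hs
  have h2 := contDiffAt_deriv h1
  have h3 := h.contDiffAt hs
  have h4 := h.lapProfile_contDiffAt hs
  unfold nOp
  fun_prop

theorem lapOp_contDiffAt {k : ℤ} {G : ℝ → ℝ} {s : ℝ}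
    (hG : ContDiffAt ℝ ∞ G s) : ContDiffAt ℝ ∞ (lapOp k G) s := by
  have h2 := contDiffAt_deriv hG
  have h3 := contDiffAt_deriv h2
  unfold lapOp
  fun_prop

/-- Only the term in `G'` contributes at this order, and its coefficient `cos A + 4 s sin A` is `1`
at `0`; the term in `G` still vanishes one order further. -/
theorem nOp_vanishesTo (h : IsArcAngle W A) {k : ℤ} {G : ℝ → ℝ} {n : ℕ} {c : ℝ}
    (hG : VanishesTo (n + 1) c G) : VanishesTo n c (nOp A k G) := by
  have h3 := h.contDiffAt h.zero_mem
  have h4 := h.lapProfile_contDiffAt h.zero_mem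
  have := (hG.deriv.mul (b := fun s => Real.cos (A s) + 4 * s * Real.sin (A s))
    (by fun_prop)).add (hG.drop.mul
      (b := fun s => lapProfile A s - 2 * k * Real.sin (A s)) (by fun_prop))
  simp only [h.map_zero, Real.cos_zero, Real.sin_zero, mul_zero, add_zero, mul_one, zero_mul]
    at this
  exact this

/-- The factor `1 / 4` is the value at `s = 0` of the coefficient of `G''`; the other two terms
vanish to higher order. -/
theorem lapOp_vanishesTo {k : ℤ} {G : ℝ → ℝ} {n : ℕ} {c : ℝ}
    (hG : VanishesTo (n + 2) c G) : VanishesTo n (c / 4) (lapOp k G) := by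
  have := ((hG.drop.drop.mul (b := fun _ => (k : ℝ) ^ 2) (by fun_prop)).add
    (hG.deriv.drop.mul (b := fun s => 4 * (1 - k) * s) (by fun_prop))).add
    (hG.deriv.deriv.mul (b := fun s => 4 * s ^ 2 + 1 / 4) (by fun_prop))
  norm_num at this
  rw [div_eq_mul_inv, ← one_div]
  exact this

theorem tendsto_a5Expr (h : IsArcAngle W A) {p : Heis} (hz : p 2 = 0) (hp : 0 < cylR p) :
    Tendsto (a5Expr (hom 1 (profile A))) (𝓝 p)
      (𝓝 (4 / (15 * Real.sqrt Real.pi) * (cylR p ^ 4)⁻¹)) := by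
  have hU := isOpen_cone h.isOpen
  have hL : ∀ s ∈ W, ContDiffAt ℝ ∞ (lapProfile A) s := fun s hs => h.lapProfile_contDiffAt hs
  have hs0 : p 2 / cylR p ^ 2 = 0 := by simp [hz]
  have hpc : p ∈ cone W := ⟨hp, by rw [hs0]; exact h.zero_mem⟩
  have rfl' : Set.EqOn (hom 1 (profile A)) (hom 1 (profile A)) (cone W) := fun _ _ => rfl
  set G₁ := nOp A (-3) (nOp A (-2) (nOp A (-1) (lapProfile A))) with hG₁
  set G₂ := nOp A (-3) (lapOp (-1) (lapProfile A)) with hG₂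
  have n1 := h.nOp_contDiffAt (k := -1) hL
  have n2 := h.nOp_contDiffAt (k := -2) n1
  have l1 : ∀ s ∈ W, ContDiffAt ℝ ∞ (lapOp (-1) (lapProfile A)) s := fun s hs =>
    lapOp_contDiffAt (hL s hs)
  have t1 : Set.EqOn (opN (hom 1 (profile A)) (opN (hom 1 (profile A)) (opN (hom 1 (profile A))
      (subLaplacian (hom 1 (profile A)))))) (hom (-4) G₁) (cone W) :=
    (opN_eqOn hU rfl' ((opN_eqOn hU rfl' ((opN_eqOn hU rfl' h.subLaplacian_dist).trans
      (h.opN_hom hL))).trans (h.opN_hom n1))).trans (h.opN_hom n2)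
  have t2 : Set.EqOn (opN (hom 1 (profile A))
      (subLaplacian (subLaplacian (hom 1 (profile A))))) (hom (-4) G₂) (cone W) :=
    (opN_eqOn hU rfl' ((subLaplacian_eqOn hU h.subLaplacian_dist).trans
      (subLaplacian_hom h.isOpen hL))).trans (h.opN_hom l1)
  have v1 : G₁ 0 = -64 := (h.nOp_vanishesTo (h.nOp_vanishesTo (h.nOp_vanishesTo
    h.lapProfile_vanishesTo))).value
  have v2 : G₂ 0 = -64 / 4 := (h.nOp_vanishesTo (lapOp_vanishesTo h.lapProfile_vanishesTo)).value
  have c1 : ContinuousAt (hom (-4) G₁) p :=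
    hom_continuousAt hp (h.nOp_contDiffAt n2 _ hpc.2).continuousAt
  have c2 : ContinuousAt (hom (-4) G₂) p :=
    hom_continuousAt hp (h.nOp_contDiffAt l1 _ hpc.2).continuousAt
  have key : Tendsto (fun q => 1 / (240 * Real.sqrt Real.pi) *
      (hom (-4) G₁ q - 8 * hom (-4) G₂ q)) (𝓝 p)
      (𝓝 (4 / (15 * Real.sqrt Real.pi) * (cylR p ^ 4)⁻¹)) := by
    have : Tendsto (fun q => 1 / (240 * Real.sqrt Real.pi) *
        (hom (-4) G₁ q - 8 * hom (-4) G₂ q)) (𝓝 p) (𝓝 (1 / (240 * Real.sqrt Real.pi) *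
        (hom (-4) G₁ p - 8 * hom (-4) G₂ p))) :=
      ((c1.sub (c2.const_mul 8)).const_mul (1 / (240 * Real.sqrt Real.pi))).tendsto
    refine this.trans (le_of_eq ?_)
    congr 1
    simp only [hom, hs0, v1, v2]
    have hπ : Real.sqrt Real.pi ≠ 0 := by positivity
    rw [zpow_neg, show ((4 : ℤ)) = ((4 : ℕ) : ℤ) by rfl, zpow_natCast]
    field_simp
    norm_num
  refine key.congr' ?_
  filter_upwards [hU.mem_nhds hpc] with q hq
  unfold a5Expr
  rw [t1 hq, t2 hq]

end IsArcAngle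

/-! ### Horizontal curves and the distance -/

theorem continuous_X₁ : Continuous X₁ := by
  unfold X₁
  refine (PiLp.continuous_toLp 2 _).comp (continuous_pi fun i => ?_)
  fin_cases i <;> simp <;> fun_prop

theorem continuous_X₂ : Continuous X₂ := by
  unfold X₂
  refine (PiLp.continuous_toLp 2 _).comp (continuous_pi fun i => ?_)
  fin_cases i <;> simp <;> fun_prop

theorem norm_sq_fin_two (v : EuclideanSpace ℝ (Fin 2)) : ‖v‖ ^ 2 = v 0 ^ 2 + v 1 ^ 2 := by
  rw [EuclideanSpace.norm_sq_eq, Fin.sum_univ_two]; simp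

theorem hasDerivAt_heis {γ : ℝ → Heis} {γ' : Heis} {t : ℝ}
    (h : ∀ i, HasDerivAt (fun s => γ s i) (γ' i) t) : HasDerivAt γ γ' t := by
  rw [hasDerivAt_iff_hasFDerivAt, ← hasFDerivWithinAt_univ, hasFDerivWithinAt_euclidean]
  intro i
  rw [hasFDerivWithinAt_univ]
  refine (h i).hasFDerivAt.congr_fderiv ?_
  ext
  simp

theorem isHorizontalCurve_of_hasDerivAt {T : ℝ} (hT : 0 ≤ T) {γ : ℝ → Heis}
    {u : ℝ → EuclideanSpace ℝ (Fin 2)} (hu : Continuous u)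
    (h : ∀ t, HasDerivAt γ (u t 0 • X₁ (γ t) + u t 1 • X₂ (γ t)) t) : IsHorizontalCurve T γ u where
  nonneg := hT
  absCont := by
    have hd : Differentiable ℝ γ := fun t => (h t).differentiableAt
    have hγ := hd.continuous
    have h1 := continuous_X₁
    have h2 := continuous_X₂
    have hC : ContDiff ℝ 1 γ := by
      rw [contDiff_one_iff_deriv]
      refine ⟨hd, ?_⟩
      rw [show deriv γ = fun t => u t 0 • X₁ (γ t) + u t 1 • X₂ (γ t) from
        funext fun t => (h t).deriv]
      fun_prop
    exact hC.contDiffOn.absolutelyContinuousOnInterval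
  memLp := by
    obtain ⟨C, hC⟩ := (isCompact_Icc (a := (0 : ℝ)) (b := T)).exists_bound_of_continuousOn
      hu.continuousOn
    refine MemLp.of_bound hu.aestronglyMeasurable C ?_
    filter_upwards [ae_restrict_mem measurableSet_Icc] with t ht using hC t ht
  hasDeriv := ae_of_all _ h

theorem curveLength_nonneg {T : ℝ} (hT : 0 ≤ T) (u : ℝ → EuclideanSpace ℝ (Fin 2)) :
    0 ≤ curveLength T u :=
  intervalIntegral.integral_nonneg hT fun _ _ => norm_nonneg _

/-- Connectivity by horizontal curves. It is needed for lower bounds on `srDist`, since the real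
infimum of an empty set is `0`. -/
theorem exists_horizontalCurve (p q : Heis) :
    ∃ (T : ℝ) (γ : ℝ → Heis) (u : ℝ → EuclideanSpace ℝ (Fin 2)),
      IsHorizontalCurve T γ u ∧ γ 0 = p ∧ γ T = q := by
  set a := q 0 - p 0
  set b := q 1 - p 1
  -- the area swept by the curve is affine in each of the two parameters `k`, `l`
  obtain ⟨k, l, hkl⟩ : ∃ k l : ℝ, q 2 - p 2 = p 0 * b / 2 - p 1 * a / 2 + k * b / 6 - a * l / 12
      + k * l / 60 := by
    -- With `k = 60 + 5a` the coefficient `k / 60 - a / 12` of `l` equals `1`, so `l` is determined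
    -- by a linear equation.
    refine ⟨60 + 5 * a, q 2 - p 2 - (p 0 * b / 2 - p 1 * a / 2 + (60 + 5 * a) * b / 6), ?_⟩
    ring
  set γ : ℝ → Heis := fun t => !₂[p 0 + a * t + k * (t - t ^ 2), p 1 + b * t + l * (t ^ 2 - t ^ 3),
    p 2 + (p 0 * (b * t + l * (t ^ 2 - t ^ 3)) - p 1 * (a * t + k * (t - t ^ 2))) / 2 +
      (a * l * (t ^ 3 / 3 - t ^ 4 / 2) + k * b * (t ^ 3 / 3) +
        k * l * (t ^ 3 / 3 - t ^ 4 / 2 + t ^ 5 / 5)) / 2] with hγ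
  set u : ℝ → EuclideanSpace ℝ (Fin 2) := fun t =>
    !₂[a + k * (1 - 2 * t), b + l * (2 * t - 3 * t ^ 2)] with hu
  have huc : Continuous u := by
    refine (PiLp.continuous_toLp 2 _).comp (continuous_pi fun i => ?_)
    fin_cases i <;> simp <;> fun_prop
  refine ⟨1, γ, u, isHorizontalCurve_of_hasDerivAt zero_le_one huc fun t => ?_, ?_, ?_⟩
  · have h1 := hasDerivAt_id' t
    have h2 := hasDerivAt_pow 2 t
    have h3 := hasDerivAt_pow 3 t
    have h4 := hasDerivAt_pow 4 t
    have h5 := hasDerivAt_pow 5 t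
    have hX := (h1.const_mul a).add ((h1.sub h2).const_mul k)
    have hY := (h1.const_mul b).add ((h2.sub h3).const_mul l)
    refine hasDerivAt_heis fun i => ?_
    fin_cases i
    · refine (((h1.const_mul a).const_add (p 0)).add ((h1.sub h2).const_mul k)).congr_deriv ?_
      simp [hu, X₁, X₂]
    · refine (((h1.const_mul b).const_add (p 1)).add ((h2.sub h3).const_mul l)).congr_deriv ?_
      simp [hu, X₁, X₂]
    · refine (((((hY.const_mul (p 0)).sub (hX.const_mul (p 1))).div_const 2).const_add (p 2)).add
        (((((h3.div_const 3).sub (h4.div_const 2)).const_mul (a * l)).add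
          ((h3.div_const 3).const_mul (k * b))).add
          ((((h3.div_const 3).sub (h4.div_const 2)).add (h5.div_const 5)).const_mul (k * l))
          |>.div_const 2)).congr_deriv ?_
      simp [hu, hγ, X₁, X₂]
      ring
  · ext i
    fin_cases i <;> simp [hγ]
  · ext i
    fin_cases i
    · simp [hγ, a]
    · simp [hγ, b]
    · simp [hγ]
      linear_combination -hkl

theorem srDist_le {T : ℝ} {γ : ℝ → Heis} {u : ℝ → EuclideanSpace ℝ (Fin 2)}
    (h : IsHorizontalCurve T γ u) : srDist (γ 0) (γ T) ≤ curveLength T u := by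
  refine csInf_le ⟨0, ?_⟩ ⟨T, γ, u, h, rfl, rfl, rfl⟩
  rintro _ ⟨T, γ, u, h, -, -, rfl⟩
  exact curveLength_nonneg h.nonneg u

theorem le_srDist {p q : Heis} {c : ℝ} (H : ∀ (T : ℝ) (γ : ℝ → Heis)
    (u : ℝ → EuclideanSpace ℝ (Fin 2)), IsHorizontalCurve T γ u → γ 0 = p → γ T = q →
      c ≤ curveLength T u) : c ≤ srDist p q := by
  refine le_csInf ?_ ?_
  · obtain ⟨T, γ, u, h, h0, hT⟩ := exists_horizontalCurve p q
    exact ⟨_, T, γ, u, h, h0, hT, rfl⟩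
  · rintro _ ⟨T, γ, u, h, h0, hT, rfl⟩
    exact H T γ u h h0 hT

theorem srDist_nonneg (p q : Heis) : 0 ≤ srDist p q :=
  le_srDist fun _ _ u h _ _ => curveLength_nonneg h.nonneg u

/-! ### Variation of functions along horizontal curves -/

theorem comp_absolutelyContinuousOnInterval {f : Heis → ℝ} {K : NNReal} {B : Set Heis}
    (hf : LipschitzOnWith K f B) {γ : ℝ → Heis} {a b : ℝ}
    (hγ : AbsolutelyContinuousOnInterval γ a b) (hB : ∀ s ∈ Set.uIcc a b, γ s ∈ B) :
    AbsolutelyContinuousOnInterval (fun s => f (γ s)) a b := by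
  rw [absolutelyContinuousOnInterval_iff] at hγ ⊢
  intro ε hε
  obtain ⟨δ, hδ, H⟩ := hγ (ε / (K + 1)) (by positivity)
  refine ⟨δ, hδ, fun E hE hlen => ?_⟩
  have h1 := H E hE hlen
  rw [lt_div_iff₀ (by positivity)] at h1
  refine lt_of_le_of_lt ?_ h1
  rw [Finset.sum_mul]
  refine Finset.sum_le_sum fun i hi => ?_
  have h2 := hE.1 i hi
  have h3 := hf.dist_le_mul _ (hB _ h2.1) _ (hB _ h2.2)
  nlinarith [dist_nonneg (x := γ (E.2 i).1) (y := γ (E.2 i).2)]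

namespace IsHorizontalCurve

variable {T : ℝ} {γ : ℝ → Heis} {u : ℝ → EuclideanSpace ℝ (Fin 2)}

theorem intervalIntegrable_norm (h : IsHorizontalCurve T γ u) :
    IntervalIntegrable (fun t => ‖u t‖) volume 0 T := by
  rw [intervalIntegrable_iff_integrableOn_Icc_of_le h.nonneg]
  exact (h.memLp.integrable (by norm_num)).norm

/-- A function with horizontal gradient bounded by `M` varies by at most `M` times the length. -/
theorem abs_sub_le (h : IsHorizontalCurve T γ u) {f : Heis → ℝ} {K : NNReal} {B : Set Heis} {M : ℝ}
    (hf : LipschitzOnWith K f B) (hd : ∀ p ∈ B, DifferentiableAt ℝ f p) (hM0 : 0 ≤ M)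
    (hM : ∀ p ∈ B, ∀ v : EuclideanSpace ℝ (Fin 2),
      |fderiv ℝ f p (v 0 • X₁ p + v 1 • X₂ p)| ≤ M * ‖v‖)
    {t : ℝ} (ht : t ∈ Set.Icc 0 T) (hB : ∀ s ∈ Set.Icc 0 t, γ s ∈ B) :
    |f (γ t) - f (γ 0)| ≤ M * curveLength T u := by
  have hac : AbsolutelyContinuousOnInterval (fun s => f (γ s)) 0 t := by
    refine comp_absolutelyContinuousOnInterval hf (h.absCont.mono ?_) ?_
    · rw [Set.uIcc_of_le ht.1, Set.uIcc_of_le h.nonneg]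
      exact Set.Icc_subset_Icc_right ht.2
    · rwa [Set.uIcc_of_le ht.1]
  have hint := h.intervalIntegrable_norm
  have hint' : IntervalIntegrable (fun s => M * ‖u s‖) volume 0 t := by
    refine (hint.mono_set ?_).const_mul M
    rw [Set.uIcc_of_le ht.1, Set.uIcc_of_le h.nonneg]
    exact Set.Icc_subset_Icc_right ht.2
  have hbound : ∀ᵐ s, s ∈ Set.Ioc 0 t → ‖deriv (fun s => f (γ s)) s‖ ≤ M * ‖u s‖ := by
    filter_upwards [(ae_restrict_iff' measurableSet_Icc).1 h.hasDeriv] with s hs hst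
    have h1 := hs ⟨hst.1.le, hst.2.trans ht.2⟩
    have hBs := hB s ⟨hst.1.le, hst.2⟩
    have h2 := (hd _ hBs).hasFDerivAt.comp_hasDerivAt s h1
    rw [show (fun s => f (γ s)) = f ∘ γ from rfl, h2.deriv]
    exact hM _ hBs _
  rw [← hac.integral_deriv_eq_sub, ← Real.norm_eq_abs]
  refine (intervalIntegral.norm_integral_le_of_norm_le ht.1 hbound hint').trans ?_
  rw [intervalIntegral.integral_const_mul]
  refine mul_le_mul_of_nonneg_left ?_ hM0
  exact intervalIntegral.integral_mono_interval le_rfl ht.1 ht.2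
    (ae_of_all _ fun _ => norm_nonneg _) hint

/-- A short curve stays close to its starting point. -/
theorem mem_closedBall (h : IsHorizontalCurve T γ u) {p₀ : Heis} {ε M : ℝ} (hM0 : 0 ≤ M)
    (hM : ∀ p ∈ Metric.closedBall p₀ ε, ∀ v : EuclideanSpace ℝ (Fin 2),
      ‖v 0 • X₁ p + v 1 • X₂ p‖ ≤ M * ‖v‖)
    (h0 : dist (γ 0) p₀ < ε / 2) (hL : M * curveLength T u < ε / 2) :
    ∀ t ∈ Set.Icc 0 T, γ t ∈ Metric.closedBall p₀ ε := by
  by_contra! hcon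
  obtain ⟨t, ht, htε⟩ := hcon
  rw [Metric.mem_closedBall, not_le] at htε
  have hε : 0 < ε := by linarith [dist_nonneg (x := γ 0) (y := p₀)]
  have hc : ContinuousOn (fun s => dist (γ s) p₀) (Set.Icc 0 T) := by
    have : ContinuousOn γ _ := h.absCont.continuousOn
    rw [Set.uIcc_of_le h.nonneg] at this
    exact continuous_dist.comp_continuousOn (this.prodMk continuousOn_const)
  set S : Set ℝ := Set.Icc 0 T ∩ (fun s => dist (γ s) p₀) ⁻¹' Set.Ici ε
  have hS : IsCompact S :=
    isCompact_Icc.of_isClosed_subset (hc.preimage_isClosed_of_isClosed isClosed_Icc isClosed_Ici)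
      Set.inter_subset_left
  -- `t₁` is the first time at distance at least `ε`. Up to `t₁` the curve lies in the closed ball,
  -- where the frame bound applies.
  obtain ⟨t₁, ⟨ht₁, hge⟩, hleast⟩ := hS.exists_isLeast ⟨t, ht, htε.le⟩
  have hsub : Set.Icc 0 t₁ ⊆ Set.Icc 0 T := Set.Icc_subset_Icc_right ht₁.2
  have heq : dist (γ t₁) p₀ = ε := by
    obtain ⟨s, hs, hsε⟩ := intermediate_value_Icc ht₁.1 (hc.mono hsub)
      (show ε ∈ Set.Icc _ _ from ⟨by linarith, hge⟩)
    have := hleast ⟨hsub hs, hsε.ge⟩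
    rwa [le_antisymm hs.2 this] at hsε
  have hball : ∀ s ∈ Set.Icc 0 t₁, γ s ∈ Metric.closedBall p₀ ε := by
    intro s hs
    by_contra hcon
    rw [Metric.mem_closedBall, not_le] at hcon
    have := hleast ⟨hsub hs, hcon.le⟩
    rw [le_antisymm hs.2 this] at hcon
    linarith
  -- Testing with the linear function `⟨v, ·⟩`, where `v` is the displacement, gives `‖v‖² ≤ ‖v‖ M
  -- L` with `L` the length. So `‖v‖ < ε / 2`, too little to reach distance `ε`.
  set v := γ t₁ - γ 0 with hv
  have key := h.abs_sub_le (f := fun p => inner ℝ v p) (K := ‖innerSL ℝ v‖₊) (M := ‖v‖ * M)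
    (B := Metric.closedBall p₀ ε) ((innerSL ℝ v).lipschitz.lipschitzOnWith)
    (fun p _ => (innerSL ℝ v).differentiableAt) (by positivity) (fun p hp w => by
      have e : fderiv ℝ (fun p => inner ℝ v p) p = innerSL ℝ v := (innerSL ℝ v).fderiv
      rw [e, innerSL_apply_apply]
      refine (abs_real_inner_le_norm _ _).trans ?_
      rw [mul_assoc]
      exact mul_le_mul_of_nonneg_left (hM p hp w) (norm_nonneg _)) ht₁ hball
  rw [← inner_sub_right, ← hv, real_inner_self_eq_norm_sq, abs_of_nonneg (by positivity),
    mul_assoc] at key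
  have htri := dist_triangle (γ t₁) (γ 0) p₀
  rw [dist_eq_norm (γ t₁) (γ 0), ← hv] at htri
  have hvpos : 0 < ‖v‖ := by linarith
  have : ‖v‖ ≤ M * curveLength T u := by nlinarith
  linarith

end IsHorizontalCurve

theorem exists_norm_frame_le (p₀ : Heis) (ε : ℝ) : ∃ M, 0 ≤ M ∧ ∀ p ∈ Metric.closedBall p₀ ε,
    ∀ v : EuclideanSpace ℝ (Fin 2), ‖v 0 • X₁ p + v 1 • X₂ p‖ ≤ M * ‖v‖ := by
  obtain ⟨M₁, h1⟩ := (isCompact_closedBall p₀ ε).exists_bound_of_continuousOn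
    continuous_X₁.continuousOn
  obtain ⟨M₂, h2⟩ := (isCompact_closedBall p₀ ε).exists_bound_of_continuousOn
    continuous_X₂.continuousOn
  refine ⟨|M₁| + |M₂|, by positivity, fun p hp v => ?_⟩
  refine (norm_add_le _ _).trans ?_
  rw [norm_smul, norm_smul, add_mul, mul_comm |M₁|, mul_comm |M₂|]
  gcongr
  · exact PiLp.norm_apply_le v 0
  · exact (h1 p hp).trans (le_abs_self _)
  · exact PiLp.norm_apply_le v 1
  · exact (h2 p hp).trans (le_abs_self _)

/-! ### The distance near a point of the plane off the origin -/

namespace IsArcAngle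

variable {W : Set ℝ} {A : ℝ → ℝ}

theorem hom_profile_eq_zero (h : IsArcAngle W A) {p : Heis} (hp : p 2 = 0) :
    hom 1 (profile A) p = 0 := by
  simp [hom, profile, hp, h.map_zero]

/-- Cauchy–Schwarz together with the eikonal equation: the model distance is a calibration. -/
theorem abs_fderiv_dist_le (h : IsArcAngle W A) {p : Heis} (hp : p ∈ cone W)
    (v : EuclideanSpace ℝ (Fin 2)) :
    |fderiv ℝ (hom 1 (profile A)) p (v 0 • X₁ p + v 1 • X₂ p)| ≤ 1 * ‖v‖ := by
  have h1 := h.gradInner_dist hp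
  have h2 := norm_sq_fin_two v
  unfold gradInner lieD at h1
  rw [map_add, map_smul, map_smul, one_mul]
  refine abs_le_of_sq_le_sq ?_ (norm_nonneg _)
  rw [h2]
  simp only [smul_eq_mul]
  generalize fderiv ℝ (hom 1 (profile A)) p (X₁ p) = a at *
  generalize fderiv ℝ (hom 1 (profile A)) p (X₂ p) = b at *
  nlinarith [sq_nonneg (v 0 * b - v 1 * a)]

/-- The minimizing arc from a point to the plane: half the chord of a circle through the axis. -/
theorem exists_arc (h : IsArcAngle W A) {q : Heis} (hq : q ∈ cone W) (hz : 0 ≤ q 2) :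
    ∃ (T : ℝ) (γ : ℝ → Heis) (u : ℝ → EuclideanSpace ℝ (Fin 2)), IsHorizontalCurve T γ u ∧
      γ 0 = q ∧ γ T 2 = 0 ∧ curveLength T u = hom 1 (profile A) q := by
  obtain ⟨hr, hs⟩ := hq
  have hα := h.nonneg _ hs (by positivity)
  have hc := h.cos_pos _ hs
  have heqn := h.eqn _ hs
  have hprof : hom 1 (profile A) q = cylR q * (A (q 2 / cylR q ^ 2) /
    Real.cos (A (q 2 / cylR q ^ 2))) := by simp [hom, profile]
  rw [hprof]
  have hsr : 4 * (q 2 / cylR q ^ 2) * cylR q ^ 2 = 4 * q 2 := by field_simp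
  generalize q 2 / cylR q ^ 2 = s at *
  generalize A s = α at *
  have hr2 := cylR_sq q
  have hsc := Real.sin_sq_add_cos_sq α
  -- `b = (b₁, b₂)` is the projection of the landing point. The circle has the segment from `0` to
  -- `b` as a diameter, of length `r / cos α`, and passes through the projection of `q`; the arc
  -- from there to `b` has central angle `2α`, run at speed half the diameter.
  set b₁ := (q 0 * Real.cos α + q 1 * Real.sin α) / Real.cos α with hb₁
  set b₂ := (q 1 * Real.cos α - q 0 * Real.sin α) / Real.cos α with hb₂
  have hb : b₁ ^ 2 + b₂ ^ 2 = (cylR q / Real.cos α) ^ 2 := by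
    rw [hb₁, hb₂, div_pow, div_pow, div_pow, ← add_div, hr2]
    congr 1
    linear_combination (q 0 ^ 2 + q 1 ^ 2) * hsc
  set γ : ℝ → Heis := fun t => !₂[(b₁ * (1 + Real.cos (2 * α - t)) - b₂ * Real.sin (2 * α - t)) / 2,
    (b₂ * (1 + Real.cos (2 * α - t)) + b₁ * Real.sin (2 * α - t)) / 2,
    (b₁ ^ 2 + b₂ ^ 2) / 8 * (2 * α - t + Real.sin (2 * α - t))] with hγ
  set u : ℝ → EuclideanSpace ℝ (Fin 2) := fun t =>
    !₂[(b₁ * Real.sin (2 * α - t) + b₂ * Real.cos (2 * α - t)) / 2,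
      (b₂ * Real.sin (2 * α - t) - b₁ * Real.cos (2 * α - t)) / 2] with hu
  have huc : Continuous u := by
    refine (PiLp.continuous_toLp 2 _).comp (continuous_pi fun i => ?_)
    fin_cases i <;> simp <;> fun_prop
  have hnorm : ∀ t, ‖u t‖ = cylR q / Real.cos α / 2 := by
    intro t
    rw [← abs_of_nonneg (norm_nonneg (u t)), ← abs_of_pos (show 0 < cylR q / Real.cos α / 2 by
      positivity), ← sq_eq_sq_iff_abs_eq_abs, norm_sq_fin_two, div_pow, ← hb]
    simp [hu]
    linear_combination (b₁ ^ 2 + b₂ ^ 2) / 4 * Real.sin_sq_add_cos_sq (2 * α - t)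
  refine ⟨2 * α, γ, u, isHorizontalCurve_of_hasDerivAt (by positivity) huc fun t => ?_, ?_, ?_, ?_⟩
  · have hθ : HasDerivAt (fun t : ℝ => 2 * α - t) (-1) t := (hasDerivAt_id' t).const_sub _
    have h1 := Real.sin_sq_add_cos_sq (2 * α - t)
    refine hasDerivAt_heis fun i => ?_
    fin_cases i
    · refine ((((hθ.cos.const_add 1).const_mul b₁).sub
        (hθ.sin.const_mul b₂)).div_const 2).congr_deriv ?_
      simp [hu, X₁, X₂]
    · refine ((((hθ.cos.const_add 1).const_mul b₂).add
        (hθ.sin.const_mul b₁)).div_const 2).congr_deriv ?_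
      simp [hu, X₁, X₂]
      ring
    · refine ((hθ.add hθ.sin).const_mul ((b₁ ^ 2 + b₂ ^ 2) / 8)).congr_deriv ?_
      simp [hu, hγ, X₁, X₂]
      linear_combination (b₁ ^ 2 + b₂ ^ 2) / 8 * h1
  · ext i
    fin_cases i
    · simp [hγ]
      rw [Real.sin_two_mul, Real.cos_two_mul, hb₁, hb₂]
      field_simp
      linear_combination (2 * q 0 * Real.cos α) * hsc
    · simp [hγ]
      rw [Real.sin_two_mul, Real.cos_two_mul, hb₁, hb₂]
      field_simp
      linear_combination (2 * q 1 * Real.cos α) * hsc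
    · simp [hγ]
      rw [hb, Real.sin_two_mul, div_pow]
      field_simp
      linear_combination 2 * cylR q ^ 2 * heqn + 2 * Real.cos α ^ 2 * hsr
  · simp [hγ]
  · unfold curveLength
    simp only [hnorm]
    rw [intervalIntegral.integral_const]
    simp
    field_simp

/-- Near a point of the plane off the origin, the distance from a set that coincides with the plane
near that point is the model distance `r F(z / r²)`. -/
theorem distFrom_eq (h : IsArcAngle W A) {S : Set Heis} {p₀ : Heis} (hz : p₀ 2 = 0)
    (hr : 0 < cylR p₀) (hS : ∀ᶠ q in 𝓝 p₀, q ∈ S ↔ q 2 = 0) :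
    ∀ᶠ q in 𝓝 p₀, 0 ≤ q 2 → distFrom S q = hom 1 (profile A) q := by
  have hp₀ : p₀ ∈ cone W := ⟨hr, by simpa [hz] using h.zero_mem⟩
  obtain ⟨ε, hε, hball⟩ := Metric.nhds_basis_closedBall.mem_iff.1
    (inter_mem ((isOpen_cone h.isOpen).mem_nhds hp₀) hS)
  have hsm : ∀ p ∈ Metric.closedBall p₀ ε, ContDiffAt ℝ ∞ (hom 1 (profile A)) p := fun p hp =>
    hom_contDiffAt (hball hp).1.1 (h.profile_contDiffAt (hball hp).1.2)
  obtain ⟨K, hK⟩ := ContDiffOn.exists_lipschitzOnWith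
    (fun p hp => (hsm p hp).contDiffWithinAt) (by simp) (convex_closedBall p₀ ε)
    (isCompact_closedBall p₀ ε)
  obtain ⟨M, hM0, hM⟩ := exists_norm_frame_le p₀ ε
  have hcw : ContinuousAt (fun q => M * hom 1 (profile A) q) p₀ :=
    (hsm p₀ (Metric.mem_closedBall_self hε.le)).continuousAt.const_mul M
  -- The model distance vanishes at `p₀`. Hence, for `q` near `p₀`, curves from `q` no longer than
  -- this value cannot leave the ball in which `S` is the plane.
  have hsmall : ∀ᶠ q in 𝓝 p₀, M * hom 1 (profile A) q < ε / 2 := by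
    refine hcw.eventually (gt_mem_nhds ?_)
    simpa [h.hom_profile_eq_zero hz] using hε
  filter_upwards [hsmall, Metric.ball_mem_nhds p₀ (half_pos hε)] with q hq hqε hqz
  have hqc : q ∈ cone W := (hball (Metric.ball_subset_closedBall
    (Metric.ball_subset_ball (by linarith) hqε))).1
  have hlower : ∀ b ∈ S, hom 1 (profile A) q ≤ srDist q b := by
    intro b hb
    refine le_srDist fun T γ u hγ h0 hT => ?_
    -- A competitor shorter than the model value stays in the ball, so its endpoint lies on the
    -- plane, where the model vanishes, and the calibration inequality is contradicted.
    by_contra! hlt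
    have hstay := hγ.mem_closedBall hM0 hM (by rw [h0]; exact hqε)
      ((mul_le_mul_of_nonneg_left hlt.le hM0).trans_lt hq)
    have hend := hball (hstay T ⟨hγ.nonneg, le_rfl⟩)
    have hb0 : b 2 = 0 := by rw [← hT]; exact hend.2.1 (by rwa [hT])
    have key := hγ.abs_sub_le hK (fun p hp => (hsm p hp).differentiableAt (by simp)) zero_le_one
      (fun p hp v => h.abs_fderiv_dist_le (hball hp).1 v) ⟨hγ.nonneg, le_rfl⟩ hstay
    rw [h0, hT, h.hom_profile_eq_zero hb0, one_mul, zero_sub, abs_neg] at key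
    linarith [le_abs_self (hom 1 (profile A) q)]
  obtain ⟨T, γ, u, hγ, h0, hT, hL⟩ := h.exists_arc hqc hqz
  have hstay := hγ.mem_closedBall hM0 hM (by rw [h0]; exact hqε) (by rwa [hL])
  have hend : γ T ∈ S := (hball (hstay T ⟨hγ.nonneg, le_rfl⟩)).2.2 hT
  refine le_antisymm ?_ ?_
  · refine (csInf_le (s := srDist q '' S) ⟨0, ?_⟩ (Set.mem_image_of_mem _ hend)).trans ?_
    · rintro _ ⟨b, -, rfl⟩
      exact srDist_nonneg q b
    · rw [← hL, ← h0]
      exact srDist_le hγ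
  · refine le_csInf (s := srDist q '' S) ⟨_, Set.mem_image_of_mem _ hend⟩ ?_
    rintro _ ⟨b, hb, rfl⟩
    exact hlower b hb

end IsArcAngle

/-! ### The integrand near the flat part of a boundary -/

theorem cylR_pos {p : Heis} (hz : p 2 = 0) (hp : p ≠ 0) : 0 < cylR p := by
  refine Real.sqrt_pos.2 ?_
  by_contra hcon
  have h0 : p 0 = 0 := by nlinarith [sq_nonneg (p 0), sq_nonneg (p 1)]
  have h1 : p 1 = 0 := by nlinarith [sq_nonneg (p 0), sq_nonneg (p 1)]
  refine hp ?_
  ext i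
  fin_cases i <;> simp [h0, h1, hz]

theorem isOpenMap_zCoord : IsOpenMap zCoord := by
  refine (EuclideanSpace.proj 2 : Heis →L[ℝ] ℝ).isOpenMap fun t => ?_
  exact ⟨EuclideanSpace.single 2 t, by simp⟩

theorem continuous_zCoord : Continuous zCoord := by unfold zCoord; fun_prop

theorem frontier_halfSpace : frontier {q : Heis | 0 < zCoord q} = {q | zCoord q = 0} := by
  have := isOpenMap_zCoord.preimage_frontier_eq_frontier_preimage continuous_zCoord (Set.Ioi 0)
  rw [frontier_Ioi] at this
  exact this.symm

theorem frequently_pos_zCoord {p : Heis} (hz : p 2 = 0) : ∃ᶠ q in 𝓝 p, 0 < zCoord q := by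
  have h : p ∈ frontier {q : Heis | 0 < zCoord q} := by rw [frontier_halfSpace]; exact hz
  exact mem_closure_iff_frequently.1 (frontier_subset_closure h)

theorem mem_frontier_congr {Ω Ω' : Set Heis} {p : Heis} (h : ∀ᶠ q in 𝓝 p, q ∈ Ω ↔ q ∈ Ω') :
    p ∈ frontier Ω ↔ p ∈ frontier Ω' := by
  have h' : ∀ᶠ q in 𝓝 p, q ∈ Ωᶜ ↔ q ∈ Ω'ᶜ := h.mono fun q hq => not_congr hq
  rw [frontier_eq_closure_inter_closure, frontier_eq_closure_inter_closure, Set.mem_inter_iff,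
    Set.mem_inter_iff, mem_closure_iff_frequently, mem_closure_iff_frequently,
    mem_closure_iff_frequently, mem_closure_iff_frequently, frequently_congr h,
    frequently_congr h']

theorem tendsto_a5Expr_distFrom {S : Set Heis} {p : Heis} (hz : p 2 = 0) (hr : 0 < cylR p)
    (hS : ∀ᶠ q in 𝓝 p, q ∈ S ↔ q 2 = 0) :
    Tendsto (a5Expr (distFrom S)) (𝓝[{q | 0 < zCoord q}] p)
      (𝓝 (4 / (15 * Real.sqrt Real.pi) * (cylR p ^ 4)⁻¹)) := by
  obtain ⟨W, A, h⟩ := exists_isArcAngle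
  obtain ⟨O, hO, hOo, hpO⟩ := mem_nhds_iff.1 (h.distFrom_eq hz hr hS)
  refine ((h.tendsto_a5Expr hz hr).mono_left nhdsWithin_le_nhds).congr' ?_
  -- The distance is compared with the model only on the side `z ≥ 0`; derivatives are compared on
  -- an open subset of `z > 0`, and the limit is taken from there.
  have hopen : IsOpen (O ∩ {q : Heis | 0 < zCoord q}) :=
    hOo.inter (isOpen_lt continuous_const continuous_zCoord)
  filter_upwards [mem_nhdsWithin_of_mem_nhds (hOo.mem_nhds hpO), self_mem_nhdsWithin] with q h1 h2
  have e : Set.EqOn (distFrom S) (hom 1 (IsArcAngle.profile A))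
      (O ∩ {q : Heis | 0 < zCoord q}) := fun q' hq' => hO hq'.1 hq'.2.le
  exact (a5Expr_eqOn hopen e ⟨h1, h2⟩).symm

/-- Near `p` the frontier and the filter `𝓝[Ω] p` depend only on `Ω` near `p`. That filter is
nontrivial, so `limUnder` is the actual limit. -/
theorem a5Integrand_eq {Ω : Set Heis} {p : Heis} (hz : p 2 = 0) (hr : 0 < cylR p)
    (hΩ : ∀ᶠ q in 𝓝 p, q ∈ Ω ↔ 0 < zCoord q) :
    a5Integrand Ω p = 4 / (15 * Real.sqrt Real.pi) * (cylR p ^ 4)⁻¹ := by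
  have hS : ∀ᶠ q in 𝓝 p, q ∈ frontier Ω ↔ q 2 = 0 := by
    filter_upwards [eventually_eventually_nhds.2 hΩ] with q hq
    rw [mem_frontier_congr (Ω' := {q : Heis | 0 < zCoord q}) hq, frontier_halfSpace]
    rfl
  have hn : 𝓝[Ω] p = 𝓝[{q | 0 < zCoord q}] p :=
    nhdsWithin_eq_iff_eventuallyEq.2 (hΩ.mono fun q hq => propext hq)
  have : (𝓝[{q | 0 < zCoord q}] p).NeBot := by
    rw [← mem_closure_iff_nhdsWithin_neBot, mem_closure_iff_frequently]
    exact frequently_pos_zCoord hz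
  unfold a5Integrand
  rw [hn]
  exact (tendsto_a5Expr_distFrom hz hr hS).limUnder_eq

theorem exists_smooth_distFrom {S : Set Heis} {p : Heis} (hz : p 2 = 0) (hr : 0 < cylR p)
    (hS : ∀ᶠ q in 𝓝 p, q ∈ S ↔ q 2 = 0) :
    ∃ U ∈ 𝓝 p, ∃ w : Heis → ℝ, ContDiffOn ℝ ∞ w U ∧
      ∀ q ∈ U, 0 ≤ zCoord q → distFrom S q = w q := by
  obtain ⟨W, A, h⟩ := exists_isArcAngle
  have hp : p ∈ cone W := ⟨hr, by simpa [hz] using h.zero_mem⟩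
  refine ⟨_, inter_mem ((isOpen_cone h.isOpen).mem_nhds hp) (h.distFrom_eq hz hr hS),
    hom 1 (IsArcAngle.profile A), fun q hq => ?_, fun q hq => hq.2⟩
  exact (hom_contDiffAt hq.1.1 (h.profile_contDiffAt hq.1.2)).contDiffWithinAt

/-! ### The surface measure of the plane -/

/-- The derivative of `u` at `p` is a nonzero multiple of `dz`. -/
def IsConormalDz (u : Heis → ℝ) (p : Heis) : Prop :=
  ∃ c : ℝ, c ≠ 0 ∧ ∀ v, fderiv ℝ u p v = c * v 2

theorem isConormalDz_zCoord (p : Heis) : IsConormalDz zCoord p := by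
  refine ⟨1, one_ne_zero, fun v => ?_⟩
  have : HasFDerivAt zCoord (EuclideanSpace.proj 2 : Heis →L[ℝ] ℝ) p :=
    (EuclideanSpace.proj 2 : Heis →L[ℝ] ℝ).hasFDerivAt
  rw [this.fderiv]
  simp

theorem IsConormalDz.isCharacteristic_iff {u : Heis → ℝ} {p : Heis} (h : IsConormalDz u p)
    (hu : u p = 0) : IsCharacteristic u p ↔ p 0 = 0 ∧ p 1 = 0 := by
  obtain ⟨c, hc, hd⟩ := h
  refine ⟨fun ⟨_, H⟩ => ?_, fun ⟨h0, h1⟩ => ⟨hu, fun v hv => ?_⟩⟩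
  · have e1 := H (X₁ p) (Submodule.subset_span (by simp))
    have e2 := H (X₂ p) (Submodule.subset_span (by simp))
    rw [hd] at e1 e2
    simpa [X₁, X₂, hc, and_comm] using And.intro e1 e2
  · obtain ⟨a, b, rfl⟩ := Submodule.mem_span_pair.1 hv
    rw [hd]
    simp [X₁, X₂, h0, h1]

/-- The factor `c` cancels up to sign in both normals, so the density depends on the tangent plane
and not on the choice of defining function. -/
theorem IsConormalDz.density {u : Heis → ℝ} {p : Heis} (h : IsConormalDz u p) :
    |inner ℝ (hNormal u p) (eNormal u p)| = cylR p / 2 := by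
  obtain ⟨c, hc, hd⟩ := h
  have hgrad : gradient u p = c • EuclideanSpace.single 2 (1 : ℝ) := by
    refine ext_inner_right ℝ fun v => ?_
    have : inner ℝ (gradient u p) v = fderiv ℝ u p v := by simp [gradient]
    rw [this, hd, real_inner_smul_left, EuclideanSpace.inner_single_left]
    simp
  have h1 : lieD X₁ u p = c * (-(p 1) / 2) := by simp [lieD, hd, X₁]
  have h2 : lieD X₂ u p = c * (p 0 / 2) := by simp [lieD, hd, X₂]
  have hg : gradInner u u p = (c * cylR p / 2) ^ 2 := by
    unfold gradInner
    rw [h1, h2, div_pow, mul_pow, cylR_sq]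
    ring
  have hh : hGrad u p 2 = c * cylR p ^ 2 / 4 := by
    unfold hGrad
    rw [h1, h2, cylR_sq]
    simp [X₁, X₂]
    ring
  unfold hNormal eNormal
  rw [hg, Real.sqrt_sq_eq_abs, hgrad, norm_smul, real_inner_smul_left, real_inner_smul_right,
    real_inner_smul_right, EuclideanSpace.inner_single_right]
  simp only [hh, PiLp.norm_single, norm_one, mul_one, one_mul, abs_mul, abs_inv, abs_abs,
    Real.norm_eq_abs, abs_div, abs_pow, abs_of_nonneg (cylR_nonneg p), conj_trivial]
  have hc' : |c| ≠ 0 := abs_ne_zero.2 hc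
  norm_num
  -- On the axis the horizontal gradient vanishes and the normal takes the value `0` by the
  -- convention for inverses, in agreement with `r / 2`.
  rcases (cylR_nonneg p).eq_or_lt with h0 | h0
  · simp [← h0]
  · field_simp
    norm_num

/-- The isometric parametrization of the plane `z = 0`. -/
def planeEmbedding (v : EuclideanSpace ℝ (Fin 2)) : Heis := !₂[v 0, v 1, 0]

theorem isometry_planeEmbedding : Isometry planeEmbedding := by
  refine Isometry.of_dist_eq fun v w => ?_
  rw [EuclideanSpace.dist_eq, EuclideanSpace.dist_eq, Fin.sum_univ_three, Fin.sum_univ_two]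
  simp [planeEmbedding]

theorem range_planeEmbedding : Set.range planeEmbedding = {p | zCoord p = 0} := by
  ext p
  refine ⟨?_, fun hp => ⟨!₂[p 0, p 1], ?_⟩⟩
  · rintro ⟨v, rfl⟩
    simp [planeEmbedding, zCoord]
  · ext i
    have : p 2 = 0 := hp
    fin_cases i <;> simp [planeEmbedding, this]

theorem measurableSet_plane : MeasurableSet {p | zCoord p = 0} :=
  (isClosed_eq continuous_zCoord continuous_const).measurableSet

theorem srSurface_zCoord : srSurface zCoord =
    ((volume : Measure (EuclideanSpace ℝ (Fin 2))).map planeEmbedding).withDensity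
      (fun p => ENNReal.ofReal (cylR p / 2)) := by
  unfold srSurface
  rw [← EuclideanSpace.euclideanHausdorffMeasure_eq_volume,
    isometry_planeEmbedding.map_euclideanHausdorffMeasure, range_planeEmbedding]
  refine withDensity_congr_ae (ae_of_all _ fun p => ?_)
  simp only [(isConormalDz_zCoord p).density]

theorem lintegral_srSurface_zCoord {f : Heis → ENNReal} (hf : Measurable f) :
    ∫⁻ p, f p ∂(srSurface zCoord) =
      ∫⁻ φ in Set.Ioo (-Real.pi) Real.pi, ∫⁻ r in Set.Ioi (0 : ℝ),
        f !₂[r * Real.cos φ, r * Real.sin φ, 0] * ENNReal.ofReal (r ^ 2 / 2) := by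
  have hD : Measurable fun p : Heis => ENNReal.ofReal (cylR p / 2) :=
    (continuous_cylR.measurable.div_const 2).ennreal_ofReal
  have hι := isometry_planeEmbedding.continuous.measurable
  have hmp : MeasurePreserving (fun x : ℝ × ℝ => (!₂[x.1, x.2] : EuclideanSpace ℝ (Fin 2))) := by
    have := (PiLp.volume_preserving_toLp (Fin 2)).comp (volume_preserving_finTwoArrow ℝ).symm
    exact this
  have hF : Measurable fun x : ℝ × ℝ => ENNReal.ofReal (cylR (planeEmbedding !₂[x.1, x.2]) / 2) *
      f (planeEmbedding !₂[x.1, x.2]) :=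
    (hD.mul hf).comp (hι.comp hmp.measurable)
  rw [srSurface_zCoord, lintegral_withDensity_eq_lintegral_mul _ hD hf,
    lintegral_map (hD.mul hf) hι]
  refine (hmp.lintegral_comp ((hD.mul hf).comp hι)).symm.trans ?_
  rw [← lintegral_comp_polarCoord_symm, polarCoord_target, Measure.volume_eq_prod,
    setLIntegral_prod_symm]
  · refine lintegral_congr fun φ => setLIntegral_congr_fun measurableSet_Ioi fun r hr => ?_
    have hr : 0 < r := hr
    have hcyl : cylR (planeEmbedding !₂[r * Real.cos φ, r * Real.sin φ]) = r := by
      simp only [cylR, planeEmbedding]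
      rw [Real.sqrt_eq_iff_mul_self_eq_of_pos hr]
      simp
      linear_combination (-r ^ 2) * Real.sin_sq_add_cos_sq φ
    simp only [polarCoord_symm_apply, Function.comp_apply, Pi.mul_apply, hcyl, smul_eq_mul]
    rw [← mul_assoc, ← ENNReal.ofReal_mul hr.le, mul_comm]
    congr 2
    ring
  · exact ((measurable_fst.ennreal_ofReal.mul
      (hF.comp continuous_polarCoord_symm.measurable)).aemeasurable)

/-! ### Divergence of the integral at the origin -/

theorem lintegral_rpow_neg_two {ε c : ℝ} (hε : 0 < ε) (hc : 0 < c) :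
    ∫⁻ r in Set.Ioo 0 ε, ENNReal.ofReal (c * r ^ (-2 : ℝ)) = ⊤ := by
  by_contra hcon
  have hmeas : AEStronglyMeasurable (fun r : ℝ => c * r ^ (-2 : ℝ))
      (volume.restrict (Set.Ioo 0 ε)) := by
    refine ContinuousOn.aestronglyMeasurable (fun r hr => ?_) measurableSet_Ioo
    exact ((Real.continuousAt_rpow_const r _ (.inl hr.1.ne')).const_mul c).continuousWithinAt
  have hnn : 0 ≤ᵐ[volume.restrict (Set.Ioo 0 ε)] fun r : ℝ => c * r ^ (-2 : ℝ) := by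
    filter_upwards [ae_restrict_mem measurableSet_Ioo] with r hr
    have := hr.1
    show 0 ≤ _
    positivity
  have hint : IntegrableOn (fun r : ℝ => c * r ^ (-2 : ℝ)) (Set.Ioo 0 ε) :=
    ⟨hmeas, (hasFiniteIntegral_iff_ofReal hnn).2 (lt_top_iff_ne_top.2 hcon)⟩
  have hint' : IntegrableOn (fun r : ℝ => r ^ (-2 : ℝ)) (Set.Ioo 0 ε) := by
    refine (hint.const_mul c⁻¹).congr (ae_of_all _ fun r => ?_)
    field_simp
  rw [intervalIntegral.integrableOn_Ioo_rpow_iff hε] at hint'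
  norm_num at hint'

/-- A function that equals `c r⁻⁴` on the plane near the origin is not integrable there. -/
theorem not_integrableOn_ball {g : Heis → ℝ} {c ε : ℝ} (hc : 0 < c) (hε : 0 < ε)
    (hg : ∀ p ∈ Metric.ball (0 : Heis) ε, p 2 = 0 → p ≠ 0 → g p = c * (cylR p ^ 4)⁻¹) :
    ¬ IntegrableOn g (Metric.ball 0 ε) (srSurface zCoord) := by
  intro hint
  set B : Set Heis := Metric.ball 0 ε
  -- The polar formula requires a measurable integrand, so `|g|` is bounded below on the plane by
  -- this explicit function; at the origin `k` is `0`, hence no information on `g 0` is needed.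
  set k : Heis → ENNReal := B.indicator fun p => ENNReal.ofReal (c * (cylR p ^ 4)⁻¹) with hk
  have hkm : Measurable k := by
    refine Measurable.indicator ?_ Metric.isOpen_ball.measurableSet
    exact (((continuous_cylR.measurable.pow_const 4).inv).const_mul c).ennreal_ofReal
  have hae : ∀ᵐ p ∂(srSurface zCoord), zCoord p = 0 :=
    (withDensity_absolutelyContinuous _ _).ae_le (ae_restrict_mem measurableSet_plane)
  have hle : ∫⁻ p, k p ∂(srSurface zCoord) ≤ ∫⁻ p in B, ‖g p‖ₑ ∂(srSurface zCoord) := by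
    rw [← lintegral_indicator Metric.isOpen_ball.measurableSet]
    refine lintegral_mono_ae (hae.mono fun p hp => ?_)
    by_cases hB : p ∈ B
    · rw [hk, Set.indicator_of_mem hB, Set.indicator_of_mem hB]
      rcases eq_or_ne p 0 with rfl | h0
      · simp [cylR]
      · rw [hg p hB hp h0, Real.enorm_eq_ofReal]
        have := cylR_nonneg p
        positivity
    · simp [hk, hB]
  have htop : ∫⁻ p, k p ∂(srSurface zCoord) = ⊤ := by
    rw [lintegral_srSurface_zCoord hkm, eq_top_iff]
    have hinner : ∀ φ : ℝ, ∫⁻ r in Set.Ioi (0 : ℝ),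
        k !₂[r * Real.cos φ, r * Real.sin φ, 0] * ENNReal.ofReal (r ^ 2 / 2) = ⊤ := by
      intro φ
      rw [eq_top_iff, ← lintegral_rpow_neg_two hε (half_pos hc)]
      refine le_trans ?_ (lintegral_mono_set fun r (hr : r ∈ Set.Ioo 0 ε) => hr.1)
      refine setLIntegral_mono' measurableSet_Ioo fun r hr => ?_
      have hr0 : 0 < r := hr.1
      have hn : Real.sqrt (r ^ 2 * Real.cos φ ^ 2 + r ^ 2 * Real.sin φ ^ 2) = r := by
        rw [← mul_add, Real.cos_sq_add_sin_sq, mul_one, Real.sqrt_sq hr0.le]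
      have hcyl : cylR !₂[r * Real.cos φ, r * Real.sin φ, 0] = r := by
        simp [cylR, mul_pow, hn]
      have hB : (!₂[r * Real.cos φ, r * Real.sin φ, 0] : Heis) ∈ B := by
        rw [Metric.mem_ball, dist_zero_right, EuclideanSpace.norm_eq, Fin.sum_univ_three]
        simp [mul_pow, hn, hr.2]
      rw [hk, Set.indicator_of_mem hB, hcyl, ← ENNReal.ofReal_mul (by positivity)]
      refine le_of_eq (congrArg _ ?_)
      rw [Real.rpow_neg hr0.le, Real.rpow_ofNat]
      field_simp
    simp only [hinner]
    rw [lintegral_const, ENNReal.top_mul]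
    simp [Real.pi_pos]
  rw [htop] at hle
  exact absurd hint.2 (by rw [HasFiniteIntegral, eq_top_iff.2 hle]; exact lt_irrefl _)

/-! ### Hypersurfaces that coincide with the plane near the origin -/

theorem srSurface_restrict_eq {u : Heis → ℝ} {B : Set Heis} (hB : MeasurableSet B)
    (h0 : ∀ p ∈ B, u p = 0 ↔ p 2 = 0) (h1 : ∀ p ∈ B, p 2 = 0 → IsConormalDz u p) :
    (srSurface u).restrict B = (srSurface zCoord).restrict B := by
  have hset : B ∩ {p | u p = 0} = B ∩ {p | zCoord p = 0} := by
    ext p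
    exact and_congr_right fun hp => h0 p hp
  unfold srSurface
  rw [restrict_withDensity hB, restrict_withDensity hB, Measure.restrict_restrict hB,
    Measure.restrict_restrict hB, hset]
  refine withDensity_congr_ae ?_
  filter_upwards [ae_restrict_mem (hB.inter measurableSet_plane)] with p hp
  rw [(h1 p hp.1 hp.2).density, (isConormalDz_zCoord p).density]

/-- A zero of `u` below the plane would be a local maximum, hence a critical point, against
regularity. On the plane `u ≤ 0`, and each point is a limit of points with `u > 0`, so `u = 0`. -/
theorem IsDefiningFunction.eventually_flat {u : Heis → ℝ} (hu : IsDefiningFunction u) {p₀ : Heis}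
    (h : ∀ᶠ p in 𝓝 p₀, 0 < u p ↔ 0 < zCoord p) : ∀ᶠ p in 𝓝 p₀, u p = 0 ↔ p 2 = 0 := by
  filter_upwards [eventually_eventually_nhds.2 h] with p hp
  have hcu : ContinuousAt u p := hu.smooth.continuous.continuousAt
  have hself : 0 < u p ↔ 0 < p 2 := hp.self_of_nhds
  constructor
  · intro h0
    by_contra hne
    have hlt : p 2 < 0 := lt_of_le_of_ne (not_lt.1 fun hpos => (hself.2 hpos).ne' h0) hne
    have hmax : IsLocalMax u p := by
      filter_upwards [hp, continuous_zCoord.continuousAt.eventually (gt_mem_nhds hlt)] with q h1 h2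
      rw [h0]
      exact not_lt.1 fun h3 => lt_asymm h2 (h1.1 h3)
    exact hu.regular p h0 hmax.fderiv_eq_zero
  · intro hz
    refine le_antisymm (not_lt.1 fun hpos => (hself.1 hpos).ne' hz) ?_
    by_contra! hneg
    obtain ⟨q, h1, h2, h3⟩ := ((frequently_pos_zCoord hz).and_eventually
      (hp.and (hcu.eventually (gt_mem_nhds hneg)))).exists
    exact lt_asymm h3 (h2.2 h1)

/-- Since `u` vanishes on the plane near `p`, its derivatives along the plane vanish; regularity
makes the remaining one nonzero. -/
theorem IsDefiningFunction.eventually_isConormalDz {u : Heis → ℝ} (hu : IsDefiningFunction u)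
    {p₀ : Heis} (h : ∀ᶠ p in 𝓝 p₀, u p = 0 ↔ p 2 = 0) :
    ∀ᶠ p in 𝓝 p₀, p 2 = 0 → IsConormalDz u p := by
  filter_upwards [eventually_eventually_nhds.2 h] with p hp hz
  have hd : DifferentiableAt ℝ u p := hu.smooth.contDiffAt.differentiableAt (by simp)
  have htan : ∀ v : Heis, v 2 = 0 → fderiv ℝ u p v = 0 := by
    intro v hv
    refine fderiv_eq_of_hasDerivAt_line hd ?_
    have hc : Tendsto (fun t : ℝ => p + t • v) (𝓝 0) (𝓝 p) := by
      have : Continuous fun t : ℝ => p + t • v := by fun_prop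
      simpa using this.tendsto 0
    refine (hasDerivAt_const (0 : ℝ) (0 : ℝ)).congr_of_eventuallyEq ?_
    filter_upwards [hc.eventually hp] with t ht
    exact ht.2 (by simp [hz, hv])
  have hall : ∀ v, fderiv ℝ u p v = fderiv ℝ u p (EuclideanSpace.single 2 1) * v 2 := by
    intro v
    have h1 := htan (v - v 2 • EuclideanSpace.single 2 1) (by simp)
    rw [map_sub, map_smul, sub_eq_zero] at h1
    rw [h1, smul_eq_mul, mul_comm]
  refine ⟨_, fun h0 => hu.regular p (hp.self_of_nhds.2 hz) ?_, hall⟩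
  ext v
  rw [hall v, h0]
  simp

theorem not_integrableOn_a5Integrand {u : Heis → ℝ} (hu : IsDefiningFunction u)
    (h : ∀ᶠ p in 𝓝 (0 : Heis), 0 < u p ↔ 0 < zCoord p) {U : Set Heis}
    (hU : U ∈ 𝓝 (0 : Heis)) :
    ¬ IntegrableOn (a5Integrand {q | 0 < u q}) U (srSurface u) := by
  intro hint
  have hflat := hu.eventually_flat h
  obtain ⟨ε, hε, hB⟩ := Metric.nhds_basis_ball.mem_iff.1 (inter_mem hU
    (hflat.and ((hu.eventually_isConormalDz hflat).and (eventually_eventually_nhds.2 h))))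
  refine not_integrableOn_ball (c := 4 / (15 * Real.sqrt Real.pi)) (by positivity) hε
    (fun p hp hz h0 => a5Integrand_eq hz (cylR_pos hz h0) (hB hp).2.2.2) ?_
  have := hint.mono_set fun p hp => (hB hp).1
  rwa [IntegrableOn, srSurface_restrict_eq Metric.isOpen_ball.measurableSet
    (fun p hp => (hB hp).2.1) (fun p hp => (hB hp).2.2.1)] at this

theorem isDefiningFunction_zCoord : IsDefiningFunction zCoord where
  smooth := by unfold zCoord; fun_prop
  regular p _ h0 := by
    obtain ⟨c, hc, h⟩ := isConormalDz_zCoord p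
    have := h (EuclideanSpace.single 2 1)
    rw [h0] at this
    simp at this
    exact hc this.symm

/-! ### A bounded domain that is flat near the origin -/

theorem deriv_expNegInvGlue_ne_zero {t : ℝ} (ht : 0 < t) : deriv expNegInvGlue t ≠ 0 := by
  have e : expNegInvGlue =ᶠ[𝓝 t] fun s => Real.exp (-s⁻¹) := by
    filter_upwards [lt_mem_nhds ht] with s hs
    simp [expNegInvGlue, not_le.2 hs]
  have hd : HasDerivAt (fun s : ℝ => Real.exp (-s⁻¹)) _ t := (hasDerivAt_inv ht.ne').fun_neg.exp
  rw [e.deriv_eq, hd.deriv]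
  simp [ht.ne']

/-- There is a bounded smooth domain that coincides with the half-space near the origin. -/
theorem exists_isFlatDomain : ∃ u : Heis → ℝ, IsFlatDomain u := by
  set ρ : Heis → ℝ := fun p => p 0 ^ 2 + p 1 ^ 2 - 1 with hρ
  -- Inside the unit cylinder the domain is the slab `0 < z < 1`; the glue function, positive
  -- outside, closes it off smoothly.
  set u : Heis → ℝ := fun p => p 2 * (1 - p 2) - expNegInvGlue (ρ p) with hu
  have hψ : ContDiff ℝ ∞ expNegInvGlue := expNegInvGlue.contDiff
  have hρs : ContDiff ℝ ∞ ρ := by fun_prop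
  have hus : ContDiff ℝ ∞ u := by
    have := hψ.comp hρs
    exact ContDiff.sub (by fun_prop) this
  have hder : ∀ p v : Heis, fderiv ℝ u p v = (1 - 2 * p 2) * v 2 -
      deriv expNegInvGlue (ρ p) * (2 * (p 0 * v 0 + p 1 * v 1)) := by
    intro p v
    refine fderiv_eq_of_hasDerivAt_line (hus.contDiffAt.differentiableAt (by simp)) ?_
    have hline : ∀ i, HasDerivAt (fun t : ℝ => (p + t • v) i) (v i) 0 := by
      intro i
      simpa using ((hasDerivAt_id (0 : ℝ)).mul_const (v i)).const_add (p i)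
    have h1 : HasDerivAt expNegInvGlue (deriv expNegInvGlue (ρ p)) (ρ (p + (0 : ℝ) • v)) := by
      simpa using (hψ.contDiffAt.differentiableAt (by simp)).hasDerivAt
    have h2 : HasDerivAt (fun t : ℝ => ρ (p + t • v)) (2 * (p 0 * v 0 + p 1 * v 1)) 0 := by
      refine ((((hline 0).pow 2).add ((hline 1).pow 2)).sub_const 1).congr_deriv ?_
      simp
      ring
    refine (((hline 2).mul ((hline 2).const_sub 1)).sub (h1.comp (0 : ℝ) h2)).congr_deriv ?_
    simp
    ring
  refine ⟨u, ⟨hus, fun p hp h0 => ?_⟩, ?_, ?_⟩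
  · have hz : p 2 = 1 / 2 := by
      have := hder p (EuclideanSpace.single 2 1)
      rw [h0] at this
      simp at this
      linarith
    have hval : expNegInvGlue (ρ p) = 1 / 4 := by
      have : p 2 * (1 - p 2) - expNegInvGlue (ρ p) = 0 := hp
      rw [hz] at this
      linarith
    have hpos : 0 < ρ p := by
      by_contra hneg
      rw [expNegInvGlue.zero_of_nonpos (not_lt.1 hneg)] at hval
      norm_num at hval
    -- At a critical zero `z = 1/2` and the glue function equals `1/4`, so `r > 1` and its
    -- derivative is nonzero; the radial derivative then forces `r = 0`.
    have := hder p !₂[p 0, p 1, 0]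
    rw [h0] at this
    simp [deriv_expNegInvGlue_ne_zero hpos] at this
    have hρp : ρ p = p 0 ^ 2 + p 1 ^ 2 - 1 := rfl
    nlinarith
  · refine (Metric.isBounded_iff_subset_closedBall (0 : Heis)).2 ⟨3, fun p hp => ?_⟩
    have hp : 0 < p 2 * (1 - p 2) - expNegInvGlue (ρ p) := hp
    have h0 := expNegInvGlue.nonneg (ρ p)
    have hz : 0 < p 2 ∧ p 2 < 1 := by constructor <;> nlinarith
    have h14 : expNegInvGlue (ρ p) < 1 / 4 := by nlinarith [sq_nonneg (p 2 - 1 / 2)]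
    -- For `ρ ≥ 1` the glue function is at least `e⁻¹ > 1/4`, whereas `z (1 - z) ≤ 1/4`.
    have hρ1 : ρ p < 1 := by
      by_contra! hge
      have h1 : expNegInvGlue (ρ p) = Real.exp (-(ρ p)⁻¹) := by
        simp [expNegInvGlue, not_le.2 (zero_lt_one.trans_le hge)]
      have h2 : Real.exp (-1) ≤ expNegInvGlue (ρ p) := by
        rw [h1, Real.exp_le_exp, neg_le_neg_iff]
        exact inv_le_one_of_one_le₀ hge
      have h3 : (1 : ℝ) / 4 < Real.exp (-1) := by
        rw [Real.exp_neg, one_div]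
        exact inv_strictAnti₀ (Real.exp_pos 1) (by linarith [Real.exp_one_lt_d9])
      linarith
    have hρp : ρ p = p 0 ^ 2 + p 1 ^ 2 - 1 := rfl
    rw [Metric.mem_closedBall, dist_zero_right, EuclideanSpace.norm_eq, Fin.sum_univ_three]
    refine Real.sqrt_le_iff.2 ⟨by norm_num, ?_⟩
    simp only [Real.norm_eq_abs, sq_abs]
    nlinarith
  · have h1 : ∀ᶠ p in 𝓝 (0 : Heis), ρ p < 0 :=
      hρs.continuous.continuousAt.eventually (gt_mem_nhds (by simp [hρ]))
    have h2 : ∀ᶠ p in 𝓝 (0 : Heis), zCoord p < 1 :=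
      continuous_zCoord.continuousAt.eventually (gt_mem_nhds (by simp [zCoord]))
    filter_upwards [h1, h2] with p hp1 hp2
    have hp2 : 0 < 1 - p 2 := sub_pos.2 hp2
    simp only [hu, zCoord, expNegInvGlue.zero_of_nonpos hp1.le, sub_zero]
    exact mul_pos_iff_of_pos_right hp2

end HeisenbergHeat

end

theorem theorem1p4 :
    -- the origin is the only characteristic point of the plane
    (∀ p : HeisenbergHeat.Heis, HeisenbergHeat.IsCharacteristic HeisenbergHeat.zCoord p ↔ p = 0) ∧
    -- in cylindrical coordinates, the surface measure is `(1/2) r² dr dφ`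
    (∀ f : HeisenbergHeat.Heis → ENNReal, Measurable f →
      ∫⁻ p, f p ∂(HeisenbergHeat.srSurface HeisenbergHeat.zCoord) =
        ∫⁻ φ in Set.Ioo (-Real.pi) Real.pi, ∫⁻ r in Set.Ioi (0 : ℝ),
          f !₂[r * Real.cos φ, r * Real.sin φ, 0] * ENNReal.ofReal (r ^ 2 / 2)) ∧
    -- away from the origin `δ` is smooth up to the plane, and the integrand of `a₅` is there the
    -- limit of `(240 √π)⁻¹ (N³ - 8 N Δ) Δδ`, with value `4 / (15 √π) r⁻⁴`
    (∀ p : HeisenbergHeat.Heis, HeisenbergHeat.zCoord p = 0 → p ≠ 0 →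
      (∃ U ∈ 𝓝 p, ∃ w : HeisenbergHeat.Heis → ℝ, ContDiffOn ℝ ∞ w U ∧
        ∀ q ∈ U, 0 ≤ HeisenbergHeat.zCoord q →
          HeisenbergHeat.distFrom {q' | HeisenbergHeat.zCoord q' = 0} q = w q) ∧
      Tendsto
        (HeisenbergHeat.a5Expr (HeisenbergHeat.distFrom {q' | HeisenbergHeat.zCoord q' = 0}))
        (𝓝[{q | 0 < HeisenbergHeat.zCoord q}] p)
        (𝓝 (4 / (15 * Real.sqrt Real.pi) * (HeisenbergHeat.cylR p ^ 4)⁻¹)) ∧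
      HeisenbergHeat.a5Integrand {q | 0 < HeisenbergHeat.zCoord q} p =
        4 / (15 * Real.sqrt Real.pi) * (HeisenbergHeat.cylR p ^ 4)⁻¹) ∧
    -- the integrand is not locally integrable around the origin
    (∀ U ∈ 𝓝 (0 : HeisenbergHeat.Heis),
      ¬ IntegrableOn (HeisenbergHeat.a5Integrand {q | 0 < HeisenbergHeat.zCoord q}) U
        (HeisenbergHeat.srSurface HeisenbergHeat.zCoord)) ∧
    -- consequently the formula for `a₅` breaks down for bounded domains with characteristic points:
    -- for every smooth bounded domain that coincides with `{z > 0}` near the origin (and there are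
    -- such domains), the origin is an isolated characteristic point of the boundary, and the
    -- integrand of `a₅` is not integrable on any neighbourhood of it
    (∃ u : HeisenbergHeat.Heis → ℝ, HeisenbergHeat.IsFlatDomain u) ∧
    (∀ u : HeisenbergHeat.Heis → ℝ, HeisenbergHeat.IsFlatDomain u →
      HeisenbergHeat.IsCharacteristic u 0 ∧
      (∀ᶠ p in 𝓝[≠] (0 : HeisenbergHeat.Heis), ¬ HeisenbergHeat.IsCharacteristic u p) ∧
      ∀ U ∈ 𝓝 (0 : HeisenbergHeat.Heis),
        ¬ IntegrableOn (HeisenbergHeat.a5Integrand {q | 0 < u q}) U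
          (HeisenbergHeat.srSurface u)) := by
  refine ⟨fun p => ?_, fun f hf => HeisenbergHeat.lintegral_srSurface_zCoord hf,
    fun p hz h0 => ?_, fun U hU => ?_, HeisenbergHeat.exists_isFlatDomain, fun u hu => ?_⟩
  · refine ⟨fun h => ?_, ?_⟩
    · by_contra h0
      have hz : p 2 = 0 := h.1
      have hr := HeisenbergHeat.cylR_pos hz h0
      obtain ⟨h1, h2⟩ := ((HeisenbergHeat.isConormalDz_zCoord p).isCharacteristic_iff h.1).1 h
      simp [HeisenbergHeat.cylR, h1, h2] at hr
    · rintro rfl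
      exact ((HeisenbergHeat.isConormalDz_zCoord 0).isCharacteristic_iff (by
        simp [HeisenbergHeat.zCoord])).2 (by simp)
  · have hr := HeisenbergHeat.cylR_pos hz h0
    have hS : ∀ᶠ q in 𝓝 p, q ∈ {q' | HeisenbergHeat.zCoord q' = 0} ↔ q 2 = 0 :=
      Eventually.of_forall fun _ => Iff.rfl
    exact ⟨HeisenbergHeat.exists_smooth_distFrom hz hr hS,
      HeisenbergHeat.tendsto_a5Expr_distFrom hz hr hS,
      HeisenbergHeat.a5Integrand_eq hz hr (Eventually.of_forall fun _ => Iff.rfl)⟩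
  · exact HeisenbergHeat.not_integrableOn_a5Integrand HeisenbergHeat.isDefiningFunction_zCoord
      (Eventually.of_forall fun _ => Iff.rfl) hU
  · obtain ⟨hdef, -, hloc⟩ := hu
    have hflat := hdef.eventually_flat hloc
    have hcon := hdef.eventually_isConormalDz hflat
    refine ⟨?_, ?_, fun U hU => HeisenbergHeat.not_integrableOn_a5Integrand hdef hloc hU⟩
    · exact ((hcon.self_of_nhds (by simp)).isCharacteristic_iff
        (hflat.self_of_nhds.2 (by simp))).2 (by simp)
    · filter_upwards [self_mem_nhdsWithin, mem_nhdsWithin_of_mem_nhds hflat,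
        mem_nhdsWithin_of_mem_nhds hcon] with p h0 h1 h2 hchar
      have hz : p 2 = 0 := h1.1 hchar.1
      obtain ⟨h3, h4⟩ := ((h2 hz).isCharacteristic_iff hchar.1).1 hchar
      have hr := HeisenbergHeat.cylR_pos hz h0
      simp [HeisenbergHeat.cylR, h3, h4] at hr
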